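/- Let $K$ be a field. A configuration is a finite set $B$ of monomials of a polynomial ring $K[u_1,\dots,u_\mu]$ whose exponent vectors lie on a hyperplane $\{{\bf a} : {\bf w}\cdot{\bf a}=1\}$ with ${\bf w}\in\mathbb R^\mu$. The toric ideal $I_B$ is the kernel of the $K$-algebra homomorphism from the polynomial ring with one variable per element of $B$ sending each variable to the corresponding monomial. A finite subset $\mathcal G$ of an ideal $I$ is a Gröbner basis of $I$ with respect to a monomial order $<$ if ${\rm in}_<(\mathcal G)={\rm in}_<(I)$, where ${\rm in}_<(S)$ denotes the ideal generated by the initial monomials of the nonzero elements of $S$; it is quadratic if ${\rm in}_<(\mathcal G)$ is generated by monomials of degree $2$. Let $B_1=\{m_1,\dots,m_6\}$ be a configuration with six distinct elements such that $I_{B_1}=\langle z_1z_2z_3-z_4z_5z_6\rangle$ (with $z_j\mapsto m_j$), let $n>1$, $A=\{t_1^n\}$, and let $A(B_1)=\{m_{j_1}\cdots m_{j_n} : 1\le j_1,\dots,j_n\le 6\}$ be the nested configuration. For a word $j_1\cdots j_n$ over $\{1,\dots,6\}$ let $x_{j_1\cdots j_n}$ be the variable corresponding to the element $m_{j_1}\cdots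 m_{j_n}$ of $A(B_1)$ (so words giving the same monomial give the same variable). A word is called standard if it does not contain all of the letters $1,2,3$. Consider the binomials (i) $\underline{x_{j_1j_2M_1}x_{j_3M_2}}-x_{j_4j_5M_1}x_{j_6M_2}$, where $\{j_1,j_2,j_3\}=\{1,2,3\}$, $\{j_4,j_5,j_6\}=\{4,5,6\}$, and $M_1,M_2$ are words of lengths $n-2$ and $n-1$; (ii) $\underline{x_{j_1\cdots j_n}x_{j_{n+1}\cdots j_{2n}}}-x_{1\cdots1j'_1\cdots j'_\alpha}x_{1\cdots1j'_{\alpha+1}\cdots j'_{2\alpha}}$, where the weakly increasing rearrangement of $j_1\cdots j_{2n}$ is $1\cdots1j'_1\cdots j'_{2\alpha}$ with $0\le\alpha\le n$ and $2(n-\alpha)$ leading $1$'s, $j'_2>1$ if $\alpha\geq 1$, and each variable of the second monomial has $n-\alpha$ leading $1$'s; where in (i) and (ii) the two words indexing the underlined monomial are standard. Then there is a monomial order such that the initial monomial of every nonzero binomial in (i) and (ii) is the underlined one, and the set of all nonzero binomials in (i) and (ii) is a quadratic Gröbner basis of $I_{A(B_1)}$ with respect to this order. The hypotheses on $B_1$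 hold for the Birkhoff polytope $\mathcal B_3$, the set of nonnegative real $3\times3$ matrices with all row and column sums $1$: the six monomials $u_{11}u_{22}u_{33}$, $u_{12}u_{23}u_{31}$, $u_{13}u_{21}u_{32}$, $u_{11}u_{23}u_{32}$, $u_{12}u_{21}u_{33}$, $u_{13}u_{22}u_{31}$, in this order, are distinct, are exactly the monomials ${\bf u}^\alpha$ with $\alpha\in\mathcal B_3\cap\mathbb Z^{3\times3}$, form a configuration, and have toric ideal $\langle z_1z_2z_3-z_4z_5z_6\rangle$. Consequently, for every integer $m>1$, the toric ideal of $m\mathcal B_3$, that is, of $\{{\bf u}^\alpha : \alpha\in m\mathcal B_3\cap\mathbb Z^{3\times3}\}$, has a quadratic Gröbner basis with respect to some monomial order. -/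

import Mathlib

open MvPolynomial
open scoped Pointwise

noncomputable section

namespace NestedToric

/-! ### Configurations and toric ideals

A monomial `t^a` of `K[t_i | i ∈ σ]` is represented by its exponent vector `a : σ →₀ ℕ`. -/

/-- A configuration: a finite set of monomials whose exponents lie on a hyperplane `w · a = 1`. -/
def IsConfiguration {σ : Type*} (A : Set (σ →₀ ℕ)) : Prop :=
  A.Finite ∧ ∃ w : σ → ℝ, ∀ a ∈ A, (a.sum fun i c => w i * (c : ℝ)) = 1

/-- The toric ideal of a listed family of monomials `(t^{a_i})_i`: the kernel of
`K[z_i | i ∈ ι] → K[t]`, `z_i ↦ t^{a_i}`. -/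
def toricIdealOfFamily (K : Type*) [Field K] {ι σ : Type*} (a : ι → σ →₀ ℕ) :
    Ideal (MvPolynomial ι K) :=
  RingHom.ker (aeval fun i => monomial (a i) (1 : K) :
    MvPolynomial ι K →ₐ[K] MvPolynomial σ K)

/-- The toric ideal of a set `A` of monomials; its variables are indexed by the elements of `A`. -/
def toricIdeal (K : Type*) [Field K] {σ : Type*} (A : Set (σ →₀ ℕ)) :
    Ideal (MvPolynomial A K) :=
  toricIdealOfFamily K (fun a : A => (a : σ →₀ ℕ))

/-! ### Gröbner bases -/

/-- The ideal generated by the initial monomials of the nonzero elements of `S`. -/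
def initialIdeal {K σ : Type*} [Field K] (ord : MonomialOrder σ) (S : Set (MvPolynomial σ K)) :
    Ideal (MvPolynomial σ K) :=
  Ideal.span ((fun f => monomial (ord.degree f) (1 : K)) '' {f | f ∈ S ∧ f ≠ 0})

/-- `G` is a (finite) Gröbner basis of `I` with respect to `ord`. -/
def IsGroebnerBasis {K σ : Type*} [Field K] (ord : MonomialOrder σ)
    (I : Ideal (MvPolynomial σ K)) (G : Set (MvPolynomial σ K)) : Prop :=
  G.Finite ∧ G ⊆ (I : Set (MvPolynomial σ K)) ∧
    initialIdeal ord G = initialIdeal ord (I : Set (MvPolynomial σ K))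

/-- The ideal `J` is generated by monomials of degree two. -/
def IsQuadraticMonomialIdeal {K σ : Type*} [Field K] (J : Ideal (MvPolynomial σ K)) : Prop :=
  ∃ S : Set (σ →₀ ℕ), (∀ s ∈ S, s.degree = 2) ∧
    J = Ideal.span ((fun s => monomial s (1 : K)) '' S)

/-- `G` is a Gröbner basis of `I` whose initial ideal is generated by quadratic monomials. -/
def IsQuadraticGroebnerBasis {K σ : Type*} [Field K] (ord : MonomialOrder σ)
    (I : Ideal (MvPolynomial σ K)) (G : Set (MvPolynomial σ K)) : Prop :=
  IsGroebnerBasis ord I G ∧ IsQuadraticMonomialIdeal (initialIdeal ord G)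

/-! ### Nested configurations -/

/-- The monomial `m` in the variables `u^{(i)}`, viewed in all variables `u^{(1)}, …, u^{(d)}`. -/
def embedMonomial {ι : Type*} {σ : ι → Type*} (i : ι) (m : σ i →₀ ℕ) : (Σ i, σ i) →₀ ℕ :=
  m.embDomain (Function.Embedding.sigmaMk i)

/-- The nested configuration `A(B_1, …, B_d)`: the products `m_1 ⋯ m_r` with `m_k ∈ B_{i_k}` and
`t_{i_1} ⋯ t_{i_r} ∈ A`. The multiset `s` lists the pairs `(i_k, m_k)`. -/
def nestedConfiguration {ι : Type*} {σ : ι → Type*} (A : Set (ι →₀ ℕ))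
    (B : ∀ i, Set (σ i →₀ ℕ)) : Set ((Σ i, σ i) →₀ ℕ) :=
  {M | ∃ s : Multiset (Σ i, σ i →₀ ℕ),
    (s.map fun p => Finsupp.single p.1 1).sum ∈ A ∧ (∀ p ∈ s, p.2 ∈ B p.1) ∧
      M = (s.map fun p => embedMonomial p.1 p.2).sum}

/-- `A(B)` for `A = {t_1^n}`, a configuration in one variable. -/
abbrev powerNested {σ : Type*} (n : ℕ) (B : Set (σ →₀ ℕ)) : Set ((Σ _ : Fin 1, σ) →₀ ℕ) :=
  nestedConfiguration (ι := Fin 1) (σ := fun _ => σ) {Finsupp.single 0 n} (fun _ => B)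

/-! ### The binomials

The letters `1, …, 6` are the elements `0, …, 5` of `Fin 6`. A word `j_1 ⋯ j_n` matters only up to
permutation of its letters, so it is an element of `Sym (Fin 6) n`. -/

/-- The index of the variable `x_{j_1 ⋯ j_n}`: the monomial `m_{j_1} ⋯ m_{j_n}` of `A(B)`, where
`B = {m_1, …, m_6}`. Different words may give the same monomial, hence the same variable. -/
def wordIndex {σ : Type*} (b : Fin 6 → σ →₀ ℕ) {n : ℕ} (W : Sym (Fin 6) n) :
    powerNested n (Set.range b) :=
  ⟨((W : Multiset (Fin 6)).map fun j =>
      embedMonomial (ι := Fin 1) (σ := fun _ => σ) 0 (b j)).sum,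
    (W : Multiset (Fin 6)).map fun j => (⟨0, b j⟩ : Σ _ : Fin 1, σ →₀ ℕ), by
      refine ⟨?_, ?_, ?_⟩
      · simp [Multiset.map_map]
      · intro p hp
        obtain ⟨j, -, rfl⟩ := Multiset.mem_map.1 hp
        exact ⟨j, rfl⟩
      · simp [Multiset.map_map]⟩

/-- A word is a standard expression (with respect to the initial monomial `z_1 z_2 z_3`) if
`z_1 z_2 z_3` does not divide `z_{j_1} ⋯ z_{j_n}`. -/
def IsStandard {n : ℕ} (W : Sym (Fin 6) n) : Prop :=
  ¬ (0 ∈ W ∧ 1 ∈ W ∧ 2 ∈ W)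

/-- `W₁ = j₁ j₂ M₁`, `W₂ = j₃ M₂`, `W₃ = j₄ j₅ M₁`, `W₄ = j₆ M₂`, where
`{j₁, j₂, j₃} = {1, 2, 3}` and `{j₄, j₅, j₆} = {4, 5, 6}`. -/
def IsTypeOne {n : ℕ} (W₁ W₂ W₃ W₄ : Sym (Fin 6) n) : Prop :=
  ∃ (j₁ j₂ j₃ j₄ j₅ j₆ : Fin 6) (M₁ M₂ : Multiset (Fin 6)),
    ({j₁, j₂, j₃} : Set (Fin 6)) = {0, 1, 2} ∧ ({j₄, j₅, j₆} : Set (Fin 6)) = {3, 4, 5} ∧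
    (W₁ : Multiset (Fin 6)) = j₁ ::ₘ j₂ ::ₘ M₁ ∧ (W₂ : Multiset (Fin 6)) = j₃ ::ₘ M₂ ∧
    (W₃ : Multiset (Fin 6)) = j₄ ::ₘ j₅ ::ₘ M₁ ∧ (W₄ : Multiset (Fin 6)) = j₆ ::ₘ M₂

/-- `sort (W₁ W₂) = 1 ⋯ 1 L₁ L₂`, where `L₁ = j'_1 ⋯ j'_α` and `L₂ = j'_{α+1} ⋯ j'_{2α}` satisfy
`j'_2 > 1`, and `W₃ = 1 ⋯ 1 L₁`, `W₄ = 1 ⋯ 1 L₂`. -/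
def IsTypeTwo {n : ℕ} (W₁ W₂ W₃ W₄ : Sym (Fin 6) n) : Prop :=
  ∃ (α : ℕ) (L₁ L₂ : List (Fin 6)), α ≤ n ∧ L₁.length = α ∧ L₂.length = α ∧
    ((W₁ : Multiset (Fin 6)) + (W₂ : Multiset (Fin 6))).sort (· ≤ ·) =
      List.replicate (2 * (n - α)) 0 ++ (L₁ ++ L₂) ∧
    (∀ j, (L₁ ++ L₂)[1]? = some j → 0 < j) ∧
    (W₃ : Multiset (Fin 6)) = ((List.replicate (n - α) 0 ++ L₁ : List (Fin 6)) : Multiset (Fin 6)) ∧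
    (W₄ : Multiset (Fin 6)) = ((List.replicate (n - α) 0 ++ L₂ : List (Fin 6)) : Multiset (Fin 6))

/-- The data of a binomial `x_{W₁} x_{W₂} - x_{W₃} x_{W₄}` of one of the two kinds; the words of
its first monomial are standard expressions. -/
def IsAdmissible {n : ℕ} (W₁ W₂ W₃ W₄ : Sym (Fin 6) n) : Prop :=
  IsStandard W₁ ∧ IsStandard W₂ ∧ (IsTypeOne W₁ W₂ W₃ W₄ ∨ IsTypeTwo W₁ W₂ W₃ W₄)

/-- The binomial `x_{W₁} x_{W₂} - x_{W₃} x_{W₄}`. -/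
def wordBinomial (K : Type*) [Field K] {σ : Type*} (b : Fin 6 → σ →₀ ℕ) {n : ℕ}
    (W₁ W₂ W₃ W₄ : Sym (Fin 6) n) : MvPolynomial (powerNested n (Set.range b)) K :=
  X (wordIndex b W₁) * X (wordIndex b W₂) - X (wordIndex b W₃) * X (wordIndex b W₄)

/-- The set of all nonzero binomials of the two kinds. -/
def quadraticBinomials (K : Type*) [Field K] {σ : Type*} (b : Fin 6 → σ →₀ ℕ) (n : ℕ) :
    Set (MvPolynomial (powerNested n (Set.range b)) K) :=
  {g | g ≠ 0 ∧ ∃ W₁ W₂ W₃ W₄ : Sym (Fin 6) n,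
    IsAdmissible W₁ W₂ W₃ W₄ ∧ g = wordBinomial K b W₁ W₂ W₃ W₄}

/-! ### The Birkhoff polytope -/

/-- The `3 × 3` transportation polytope with row sums `r` and column sums `c`. -/
def transportationPolytope (r c : Fin 3 → ℕ) : Set (Matrix (Fin 3) (Fin 3) ℝ) :=
  {A | (∀ i j, 0 ≤ A i j) ∧ (∀ k, ∑ i, A i k = c k) ∧ (∀ l, ∑ j, A l j = r l)}

/-- The Birkhoff polytope `B_3`. -/
def birkhoffPolytope : Set (Matrix (Fin 3) (Fin 3) ℝ) :=
  transportationPolytope (fun _ => 1) (fun _ => 1)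

/-- The monomials `u^α` with `α` a lattice point of `P`, for `P` a set of nonnegative matrices. -/
def latticeConfiguration (P : Set (Matrix (Fin 3) (Fin 3) ℝ)) : Set (Fin 3 × Fin 3 →₀ ℕ) :=
  {a | (Matrix.of fun i j => (a (i, j) : ℝ)) ∈ P}

/-- The monomials `u₁₁u₂₂u₃₃, u₁₂u₂₃u₃₁, u₁₃u₂₁u₃₂, u₁₁u₂₃u₃₂, u₁₂u₂₁u₃₃, u₁₃u₂₂u₃₁`. -/
def birkhoffMonomial (k : Fin 6) : Fin 3 × Fin 3 →₀ ℕ :=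
  ∑ i : Fin 3, Finsupp.single (i, (![![0, 1, 2], ![1, 2, 0], ![2, 0, 1],
    ![0, 2, 1], ![1, 0, 2], ![2, 1, 0]] : Fin 6 → Fin 3 → Fin 3) k i) 1

end NestedToric

end

/-! Words stand for monomials in `z₁,…,z₆`, and two words have the same image exactly when their
exponents differ by a multiple of (1,1,1,-1,-1,-1) (`Cong`). Each class has one standard word, so
every variable has a canonical word.

By `isGroebnerBasis_of_binomials` it suffices to find an order selecting the underlined monomials,
and to show that monomials divisible by none of them are separated by their images. For the second
point, irreducibility under (i) makes the product of any two words of the monomial standard, and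
irreducibility under (ii) makes any two of its words a sorted pair (`IsReduced`). As `n > 1`, the
product of all the words is then standard (`standard_sum`), so the image determines that product; a
pairwise sorted family is recovered from its product by peeling off its first word (`eq_of_sum_eq`).

The order refines a weight with three tiers. (i) lowers the number of letters 1, 2, 3. (ii) either
lowers that number after standardization, or balances the 1's, lowering the sum of their squared
counts, or keeps these counts and spreads the letter sums, raising their sum of squares.

For the Birkhoff polytope, lattice points of the dilations are sums of permutation matrices and
satisfy the same congruence criterion, so the same theorem applies. -/

namespace NestedToric

/-! ### Weighted lexicographic orders -/

section WeightOrder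

variable {ι : Type*}

/-- The additive map recording the weight of an exponent vector and the vector itself. -/
noncomputable def weightLexHom (wt : ι → ℕ) : (ι →₀ ℕ) →+ ℕ ×ₗ Lex (ι →₀ ℕ) where
  toFun d := toLex (Finsupp.linearCombination ℕ wt d, toLex d)
  map_zero' := by simp
  map_add' d e := by simp [map_add]; rfl

theorem weightLexHom_injective (wt : ι → ℕ) : Function.Injective (weightLexHom wt) := by
  intro d e h
  have := congrArg (fun z => (ofLex z).2) h
  exact this

/-- The exponent vectors, identified with the range of `weightLexHom`. -/
noncomputable def weightLexEquiv (wt : ι → ℕ) :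
    (ι →₀ ℕ) ≃+ AddMonoidHom.mrange (weightLexHom wt) :=
  AddEquiv.ofBijective (weightLexHom wt).mrangeRestrict
    ⟨fun _ _ h => weightLexHom_injective wt (congrArg Subtype.val h),
      (weightLexHom wt).mrangeRestrict_surjective⟩

/-- The monomial order comparing weights first and breaking ties lexicographically. -/
noncomputable def weightLex [LinearOrder ι] [WellFoundedGT ι] (wt : ι → ℕ) : MonomialOrder ι where
  -- Inside the lexicographic product, the range inherits the order structure and well-foundedness;
  -- only monotonicity needs an argument.
  syn := AddMonoidHom.mrange (weightLexHom wt)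
  toSyn := weightLexEquiv wt
  toSyn_monotone := by
    intro d e h
    obtain ⟨f, rfl⟩ := exists_add_of_le h
    rw [map_add]
    change weightLexHom wt d ≤ weightLexHom wt d + weightLexHom wt f
    refine le_add_of_nonneg_right ?_
    change toLex ((0 : ℕ), (toLex 0 : Lex (ι →₀ ℕ))) ≤ toLex (_, _)
    rw [Prod.Lex.toLex_le_toLex]
    rcases Nat.eq_zero_or_pos (Finsupp.linearCombination ℕ wt f) with h0 | h0
    · exact Or.inr ⟨h0.symm, Finsupp.toLex_monotone zero_le⟩
    · exact Or.inl h0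

theorem weightLex_lt [LinearOrder ι] [WellFoundedGT ι] (wt : ι → ℕ) {d e : ι →₀ ℕ}
    (h : Finsupp.linearCombination ℕ wt d < Finsupp.linearCombination ℕ wt e) :
    (weightLex wt).toSyn d < (weightLex wt).toSyn e := by
  change (toLex (_, _) : ℕ ×ₗ Lex (ι →₀ ℕ)) < toLex (_, _)
  exact Prod.Lex.toLex_lt_toLex.2 (Or.inl h)

end WeightOrder

/-! ### Toric ideals and binomials -/

section Toric

variable {K : Type*} [Field K] {ι τ : Type*}

theorem aeval_monomial_family (a : ι → τ →₀ ℕ) (d : ι →₀ ℕ) (c : K) :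
    (aeval fun i => monomial (a i) (1 : K) : MvPolynomial ι K →ₐ[K] MvPolynomial τ K)
      (monomial d c) = monomial (Finsupp.linearCombination ℕ a d) c := by
  rw [aeval_monomial, Finsupp.linearCombination_apply, Finsupp.prod]
  simp only [monomial_pow, one_pow]
  rw [Finsupp.sum, monomial_sum_index]
  rfl

theorem monomial_sub_mem_toricIdealOfFamily_iff (a : ι → τ →₀ ℕ) (d e : ι →₀ ℕ) :
    monomial d (1 : K) - monomial e 1 ∈ toricIdealOfFamily K a ↔
      Finsupp.linearCombination ℕ a d = Finsupp.linearCombination ℕ a e := by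
  rw [toricIdealOfFamily, RingHom.mem_ker, map_sub, sub_eq_zero]
  erw [aeval_monomial_family, aeval_monomial_family]
  exact (monomial_left_injective one_ne_zero).eq_iff

/-- A polynomial of a toric ideal has another monomial in the fibre of each of its monomials. -/
theorem exists_ne_mem_support_of_mem_toricIdealOfFamily (a : ι → τ →₀ ℕ) {f : MvPolynomial ι K}
    (hf : f ∈ toricIdealOfFamily K a) {d : ι →₀ ℕ} (hd : d ∈ f.support) :
    ∃ e ∈ f.support, e ≠ d ∧
      Finsupp.linearCombination ℕ a e = Finsupp.linearCombination ℕ a d := by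
  classical
  -- Otherwise nothing cancels the image of `d`, and its coefficient there is that of `f` at `d`.
  by_contra! hcon
  have h0 : (aeval fun i => monomial (a i) (1 : K) : MvPolynomial ι K →ₐ[K] MvPolynomial τ K) f
      = 0 := hf
  rw [f.as_sum, map_sum] at h0
  simp only [aeval_monomial_family] at h0
  have h1 := congrArg (coeff (Finsupp.linearCombination ℕ a d)) h0
  rw [coeff_sum, Finset.sum_eq_single d] at h1
  · rw [coeff_monomial, if_pos rfl, coeff_zero] at h1
    exact mem_support_iff.1 hd h1
  · intro e he hne
    rw [coeff_monomial, if_neg (hcon e he hne)]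
  · exact fun h => absurd hd h

/-- A toric ideal is contained in every ideal containing its binomials. -/
theorem toricIdealOfFamily_le (a : ι → τ →₀ ℕ) (J : Ideal (MvPolynomial ι K))
    (hJ : ∀ d e, Finsupp.linearCombination ℕ a d = Finsupp.linearCombination ℕ a e →
      monomial d (1 : K) - monomial e 1 ∈ J) : toricIdealOfFamily K a ≤ J := by
  classical
  intro f hf
  induction h : f.support.card using Nat.strong_induction_on generalizing f with
  | _ k ih =>
    rcases eq_or_ne f 0 with rfl | hne
    · exact J.zero_mem
    obtain ⟨d, hd⟩ := support_nonempty.2 hne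
    obtain ⟨e, he, hed, hae⟩ := exists_ne_mem_support_of_mem_toricIdealOfFamily a hf hd
    -- Subtracting `g` kills the monomial `d` and otherwise only changes the coefficient at `e`,
    -- already in the support, so the support shrinks.
    set g : MvPolynomial ι K := C (f.coeff d) * (monomial d (1 : K) - monomial e 1) with hg
    have hgI : g ∈ toricIdealOfFamily K a :=
      Ideal.mul_mem_left _ _ ((monomial_sub_mem_toricIdealOfFamily_iff a d e).2 hae.symm)
    have hcoeff : ∀ c, (f - g).coeff c =
        f.coeff c - f.coeff d * ((if d = c then 1 else 0) - if e = c then 1 else 0) := by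
      intro c
      rw [coeff_sub, hg, coeff_C_mul, coeff_sub, coeff_monomial, coeff_monomial]
    have hlt : (f - g).support.card < k := by
      rw [← h]
      apply Finset.card_lt_card
      rw [Finset.ssubset_iff_of_subset]
      · refine ⟨d, hd, ?_⟩
        rw [notMem_support_iff, hcoeff, if_pos rfl, if_neg hed]
        ring
      · intro c hc
        by_contra hcf
        have hcd : d ≠ c := by rintro rfl; exact hcf hd
        have hce : e ≠ c := by rintro rfl; exact hcf he
        rw [mem_support_iff, hcoeff, if_neg hcd, if_neg hce, notMem_support_iff.1 hcf] at hc
        simp at hc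
    have := J.add_mem (ih _ hlt ((toricIdealOfFamily K a).sub_mem hf hgI) rfl)
      (J.mul_mem_left (C (f.coeff d)) (hJ d e hae.symm))
    rwa [← hg, sub_add_cancel] at this

theorem degree_monomial_sub_monomial (ord : MonomialOrder ι) {p q : ι →₀ ℕ}
    (h : ord.toSyn q < ord.toSyn p) :
    ord.degree (monomial p (1 : K) - monomial q 1) = p := by
  classical
  rw [sub_eq_add_neg, MonomialOrder.degree_add_of_lt] <;>
    simp [MonomialOrder.degree_neg, MonomialOrder.degree_monomial, h]

/-- Binomials of a toric ideal form a Gröbner basis as soon as distinct monomials divisible by no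
initial monomial have distinct images. -/
theorem isGroebnerBasis_of_binomials (ord : MonomialOrder ι) (a : ι → τ →₀ ℕ)
    (G : Set (MvPolynomial ι K)) (hfin : G.Finite)
    (hG : ∀ g ∈ G, ∃ p q, g = monomial p (1 : K) - monomial q 1 ∧ ord.toSyn q < ord.toSyn p ∧
      Finsupp.linearCombination ℕ a p = Finsupp.linearCombination ℕ a q)
    (hred : ∀ d e, (∀ g ∈ G, ¬ ord.degree g ≤ d) → (∀ g ∈ G, ¬ ord.degree g ≤ e) →
      Finsupp.linearCombination ℕ a d = Finsupp.linearCombination ℕ a e → d = e) :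
    IsGroebnerBasis ord (toricIdealOfFamily K a) G := by
  have hGI : G ⊆ (toricIdealOfFamily K a : Set (MvPolynomial ι K)) := by
    intro g hg
    obtain ⟨p, q, rfl, -, hpq⟩ := hG g hg
    exact (monomial_sub_mem_toricIdealOfFamily_iff a p q).2 hpq
  have hGne : ∀ g ∈ G, g ≠ 0 := by
    rintro g hg rfl
    obtain ⟨p, q, h, hlt, -⟩ := hG 0 hg
    rw [eq_comm, sub_eq_zero] at h
    rw [monomial_left_injective (one_ne_zero) h] at hlt
    exact lt_irrefl _ hlt
  -- Rewriting `p` to `q` stays in the fibre and descends in a well-founded order, so normal forms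
  -- exist.
  have hnf : ∀ d, ∃ e, ord.toSyn e ≤ ord.toSyn d ∧ (∀ g ∈ G, ¬ ord.degree g ≤ e) ∧
      Finsupp.linearCombination ℕ a e = Finsupp.linearCombination ℕ a d := by
    intro d
    induction hs : ord.toSyn d using WellFoundedLT.induction generalizing d with
    | _ s ih =>
      subst hs
      by_cases hd : ∀ g ∈ G, ¬ ord.degree g ≤ d
      · exact ⟨d, le_rfl, hd, rfl⟩
      push Not at hd
      obtain ⟨g, hg, hgd⟩ := hd
      obtain ⟨p, q, rfl, hlt, hpq⟩ := hG g hg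
      rw [degree_monomial_sub_monomial ord hlt] at hgd
      obtain ⟨c, rfl⟩ := exists_add_of_le hgd
      have hlt' : ord.toSyn (q + c) < ord.toSyn (p + c) := by
        rw [map_add, map_add]
        exact add_lt_add_left hlt _
      obtain ⟨e, he, hre, hae⟩ := ih _ hlt' (q + c) rfl
      exact ⟨e, he.trans hlt'.le, hre, by rw [hae, map_add, map_add, hpq]⟩
  refine ⟨hfin, hGI, le_antisymm (Ideal.span_mono ?_) (Ideal.span_le.2 ?_)⟩
  · exact Set.image_mono fun f hf => ⟨hGI hf.1, hf.2⟩
  rintro _ ⟨f, ⟨hfI, hf0⟩, rfl⟩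
  -- If the leading monomial were irreducible, it would be the normal form of a smaller monomial of
  -- `f` in its fibre, although normal forms never go up.
  by_cases hd : ∀ g ∈ G, ¬ ord.degree g ≤ ord.degree f
  · exfalso
    obtain ⟨e, he, hne, hae⟩ :=
      exists_ne_mem_support_of_mem_toricIdealOfFamily a hfI (ord.degree_mem_support hf0)
    obtain ⟨c, hc, hrc, hac⟩ := hnf e
    have hcd := hred c _ hrc hd (hac.trans hae)
    subst hcd
    exact hne (ord.toSyn.injective (le_antisymm (ord.le_degree he) hc))
  · push Not at hd
    obtain ⟨g, hg, hgd⟩ := hd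
    obtain ⟨c, hc⟩ := exists_add_of_le hgd
    have : monomial (ord.degree f) (1 : K) = monomial c 1 * monomial (ord.degree g) 1 := by
      rw [monomial_mul, one_mul, hc, add_comm]
    change monomial (ord.degree f) (1 : K) ∈ initialIdeal ord G
    rw [this]
    exact Ideal.mul_mem_left _ _ (Ideal.subset_span ⟨g, ⟨hg, hGne g hg⟩, rfl⟩)

end Toric

/-! ### Words up to the relation `z₁z₂z₃ = z₄z₅z₆` -/

/-- No letter triple `1, 2, 3` divides the word. -/
def Standard (U : Multiset (Fin 6)) : Prop := ¬ (0 ∈ U ∧ 1 ∈ U ∧ 2 ∈ U)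

/-- The exponent vectors of `U` and `U'` differ by a multiple of `(1, 1, 1, -1, -1, -1)`. -/
def Cong (U U' : Multiset (Fin 6)) : Prop :=
  U.count 0 + U.count 3 = U'.count 0 + U'.count 3 ∧
  U.count 0 + U.count 4 = U'.count 0 + U'.count 4 ∧
  U.count 0 + U.count 5 = U'.count 0 + U'.count 5 ∧
  U.count 1 + U.count 3 = U'.count 1 + U'.count 3 ∧
  U.count 2 + U.count 3 = U'.count 2 + U'.count 3

theorem standard_iff {U : Multiset (Fin 6)} :
    Standard U ↔ U.count 0 = 0 ∨ U.count 1 = 0 ∨ U.count 2 = 0 := by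
  simp only [Standard, ← Multiset.count_pos]
  omega

theorem Standard.mono {U V : Multiset (Fin 6)} (h : Standard V) (hUV : U ≤ V) : Standard U :=
  fun ⟨h0, h1, h2⟩ =>
    h ⟨Multiset.mem_of_le hUV h0, Multiset.mem_of_le hUV h1, Multiset.mem_of_le hUV h2⟩

theorem card_eq_sum_counts (U : Multiset (Fin 6)) :
    U.card = U.count 0 + U.count 1 + U.count 2 + U.count 3 + U.count 4 + U.count 5 := by
  rw [← Multiset.sum_count_eq_card (s := Finset.univ) (fun a _ => Finset.mem_univ a)]
  exact Fin.sum_univ_six _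

theorem mem_multiset_sum {α : Type*} {S : Multiset (Multiset α)} {x : α} :
    x ∈ S.sum ↔ ∃ V ∈ S, x ∈ V := by
  induction S using Multiset.induction_on with
  | empty => simp
  | cons V T ih => simp [ih]

theorem ext_counts {U V : Multiset (Fin 6)} (h0 : U.count 0 = V.count 0)
    (h1 : U.count 1 = V.count 1) (h2 : U.count 2 = V.count 2) (h3 : U.count 3 = V.count 3)
    (h4 : U.count 4 = V.count 4) (h5 : U.count 5 = V.count 5) : U = V := by
  ext j
  fin_cases j <;> assumption

namespace Cong

theorem refl (U : Multiset (Fin 6)) : Cong U U := ⟨rfl, rfl, rfl, rfl, rfl⟩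

theorem symm {U V : Multiset (Fin 6)} (h : Cong U V) : Cong V U := by
  obtain ⟨h1, h2, h3, h4, h5⟩ := h
  exact ⟨h1.symm, h2.symm, h3.symm, h4.symm, h5.symm⟩

theorem trans {U V W : Multiset (Fin 6)} (h : Cong U V) (h' : Cong V W) : Cong U W := by
  obtain ⟨h1, h2, h3, h4, h5⟩ := h
  obtain ⟨h1', h2', h3', h4', h5'⟩ := h'
  exact ⟨h1.trans h1', h2.trans h2', h3.trans h3', h4.trans h4', h5.trans h5'⟩

theorem add {U V U' V' : Multiset (Fin 6)} (h : Cong U V) (h' : Cong U' V') :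
    Cong (U + U') (V + V') := by
  simp only [Cong, Multiset.count_add] at *
  omega

theorem card_eq {U V : Multiset (Fin 6)} (h : Cong U V) : U.card = V.card := by
  simp only [Cong, card_eq_sum_counts] at *
  omega

/-- A nonzero multiple of (1,1,1,-1,-1,-1) would force one of the two words to contain all of the
letters 0, 1, 2. -/
theorem eq_of_standard {U V : Multiset (Fin 6)} (h : Cong U V) (hU : Standard U)
    (hV : Standard V) : U = V := by
  rw [standard_iff] at hU hV
  obtain ⟨h1, h2, h3, h4, h5⟩ := h
  apply ext_counts <;> omega

end Cong

theorem cong_insert (T : Multiset (Fin 6)) : Cong ({0, 1, 2} + T) ({3, 4, 5} + T) := by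
  refine Cong.add ?_ (Cong.refl T)
  unfold Cong
  decide

/-- Replacing 0, 1, 2 by 3, 4, 5 lowers the count of 0, so it terminates. No cancellation is assumed
in `M`, which allows the additive form of a quotient ring below. -/
theorem exists_standard_sum {M : Type*} [AddCommMonoid M] (b : Fin 6 → M)
    (hb : b 0 + b 1 + b 2 = b 3 + b 4 + b 5) (U : Multiset (Fin 6)) :
    ∃ V, Standard V ∧ Cong U V ∧ (U.map b).sum = (V.map b).sum := by
  induction h : U.count 0 using Nat.strong_induction_on generalizing U with
  | _ k ih =>
    by_cases hU : Standard U
    · exact ⟨U, hU, Cong.refl U, rfl⟩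
    · have hle : ({0, 1, 2} : Multiset (Fin 6)) ≤ U := by
        rw [Standard, not_not] at hU
        rw [Multiset.le_iff_subset (by decide)]
        intro j hj
        simp only [Multiset.insert_eq_cons, Multiset.mem_cons, Multiset.mem_singleton] at hj
        rcases hj with rfl | rfl | rfl
        exacts [hU.1, hU.2.1, hU.2.2]
      obtain ⟨T, rfl⟩ := exists_add_of_le hle
      have h3 : ({3, 4, 5} : Multiset (Fin 6)).count 0 = 0 := by decide
      have h0 : ({0, 1, 2} : Multiset (Fin 6)).count 0 = 1 := by decide
      rw [Multiset.count_add, h0] at h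
      obtain ⟨V, hV, hc, hs⟩ := ih (({3, 4, 5} + T).count 0)
        (by rw [Multiset.count_add, h3]; omega) _ rfl
      refine ⟨V, hV, (cong_insert T).trans hc, ?_⟩
      rw [← hs]
      simp only [Multiset.map_add, Multiset.sum_add, Multiset.insert_eq_cons, Multiset.map_cons,
        Multiset.sum_cons, Multiset.map_singleton, Multiset.sum_singleton, ← add_assoc, hb]

theorem exists_standard (U : Multiset (Fin 6)) : ∃ V, Standard V ∧ Cong U V := by
  obtain ⟨V, hV, hc, -⟩ := exists_standard_sum (fun _ => (0 : ℕ)) rfl U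
  exact ⟨V, hV, hc⟩

/-- Congruent words have the same image whenever the defining relation holds. -/
theorem Cong.sum_eq {M : Type*} [AddCommMonoid M] {b : Fin 6 → M}
    (hb : b 0 + b 1 + b 2 = b 3 + b 4 + b 5) {U V : Multiset (Fin 6)} (h : Cong U V) :
    (U.map b).sum = (V.map b).sum := by
  obtain ⟨U', hU', hc, hs⟩ := exists_standard_sum b hb U
  obtain ⟨V', hV', hc', hs'⟩ := exists_standard_sum b hb V
  rw [hs, hs', (hc.symm.trans (h.trans hc')).eq_of_standard hU' hV']

/-- The number of letters `1, 2, 3`. -/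
def headCount (U : Multiset (Fin 6)) : ℕ := U.count 0 + U.count 1 + U.count 2

theorem headCount_add (U V : Multiset (Fin 6)) :
    headCount (U + V) = headCount U + headCount V := by
  simp only [headCount, Multiset.count_add]
  omega

/-- The standard word is the unique minimizer of the head count in its class. -/
theorem Cong.headCount_le {U V : Multiset (Fin 6)} (h : Cong U V) (hV : Standard V) :
    headCount V ≤ headCount U ∧ (headCount V = headCount U → V = U) := by
  rw [standard_iff] at hV
  obtain ⟨h1, h2, h3, h4, h5⟩ := h
  refine ⟨by unfold headCount; omega, fun he => ?_⟩
  unfold headCount at he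
  apply ext_counts <;> omega

/-! ### Sorted pairs of words -/

/-- `V` precedes `W` in the sorting order: the letter `1` is evenly distributed, with the surplus
in `V`, and the remaining letters of `W` are at least those of `V`. -/
def Precedes (V W : Multiset (Fin 6)) : Prop :=
  W.count 0 ≤ V.count 0 ∧ V.count 0 ≤ W.count 0 + 1 ∧ ∀ x ∈ V, ∀ y ∈ W, y ≠ 0 → x ≤ y

/-- The words of a monomial none of whose quadratic factors can be rewritten. -/
structure IsReduced (n : ℕ) (S : Multiset (Multiset (Fin 6))) : Prop where
  card_eq : ∀ V ∈ S, V.card = n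
  standard : ∀ V ∈ S, Standard V
  standard_add : ∀ V W, {V, W} ≤ S → Standard (V + W)
  precedes : ∀ V W, {V, W} ≤ S → Precedes V W ∨ Precedes W V

namespace IsReduced

variable {n : ℕ} {S S' : Multiset (Multiset (Fin 6))}

theorem mono (h : IsReduced n S) (hS : S' ≤ S) : IsReduced n S' where
  card_eq V hV := h.card_eq V (Multiset.mem_of_le hS hV)
  standard V hV := h.standard V (Multiset.mem_of_le hS hV)
  standard_add V W hV := h.standard_add V W (hV.trans hS)
  precedes V W hV := h.precedes V W (hV.trans hS)

theorem exists_head (h : IsReduced n S) (hS : S ≠ 0) :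
    ∃ F T, S = F ::ₘ T ∧ ∀ V ∈ T, Precedes F V := by
  induction S using Multiset.induction_on with
  | empty => exact absurd rfl hS
  | cons V₀ T ih =>
    rcases eq_or_ne T 0 with rfl | hT
    · exact ⟨V₀, 0, rfl, by simp⟩
    obtain ⟨F, R, rfl, hF⟩ := ih (h.mono (Multiset.le_cons_self _ _)) hT
    have hpair : ∀ V ∈ F ::ₘ R, ({V₀, V} : Multiset (Multiset (Fin 6))) ≤ V₀ ::ₘ F ::ₘ R :=
      fun V hV => Multiset.cons_le_cons _ (Multiset.singleton_le.2 hV)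
    rcases h.precedes _ _ (hpair F (Multiset.mem_cons_self _ _)) with hVF | hFV
    · refine ⟨V₀, F ::ₘ R, rfl, fun V hV => ?_⟩
      rcases Multiset.mem_cons.1 hV with rfl | hVR
      · exact hVF
      have hFV := hF V hVR
      refine ⟨hFV.1.trans hVF.1, ?_, fun x hx y hy hy0 => ?_⟩
      -- The surplus bound is not transitive; it comes from comparing `V₀` with `V` directly.
      · rcases h.precedes _ _ (hpair V hV) with h1 | h1
        · exact h1.2.1
        · exact h1.1.trans (Nat.le_succ _)
      -- Transitivity passes through a nonzero letter of `F`; if there is none, `V₀` has as many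
      -- zeros as `F` and so consists of zeros too.
      · by_cases hz : ∃ z ∈ F, z ≠ 0
        · obtain ⟨z, hz, hz0⟩ := hz
          exact (hVF.2.2 x hx z hz hz0).trans (hFV.2.2 z hz y hy hy0)
        · push Not at hz
          have hFn : F.count 0 = n := by
            rw [Multiset.count_eq_card.2 fun z hz' => (hz z hz').symm]
            exact h.card_eq F (by simp)
          have hV₀n : V₀.card = n := h.card_eq V₀ (by simp)
          have : V₀.count 0 = V₀.card :=
            le_antisymm (Multiset.count_le_card _ _) (by rw [hV₀n, ← hFn]; exact hVF.1)
          rw [← Multiset.count_eq_card.1 this x hx]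
          exact Fin.zero_le y
    · refine ⟨F, V₀ ::ₘ R, Multiset.cons_swap _ _ _, fun V hV => ?_⟩
      rcases Multiset.mem_cons.1 hV with rfl | hVR
      · exact hFV
      · exact hF V hVR

theorem card_sum (h : IsReduced n S) : S.sum.card = n * S.card := by
  induction S using Multiset.induction_on with
  | empty => simp
  | cons V T ih =>
    rw [Multiset.sum_cons, Multiset.card_add, ih (h.mono (Multiset.le_cons_self _ _)),
      h.card_eq V (by simp), Multiset.card_cons]
    ring

/-- The number of zeros in the head is the total number of zeros divided by the number of words,
rounded up. -/
theorem count_head {F : Multiset (Fin 6)} (T : Multiset (Multiset (Fin 6)))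
    (hF : ∀ V ∈ T, Precedes F V) :
    (F ::ₘ T).sum.count 0 ≤ (F ::ₘ T).card * F.count 0 ∧
      (F ::ₘ T).card * F.count 0 < (F ::ₘ T).sum.count 0 + (F ::ₘ T).card := by
  induction T using Multiset.induction_on with
  | empty => simp
  | cons V R ih =>
    obtain ⟨h1, h2⟩ := ih fun W hW => hF W (Multiset.mem_cons_of_mem hW)
    obtain ⟨h3, h4, -⟩ := hF V (Multiset.mem_cons_self _ _)
    simp only [Multiset.sum_cons, Multiset.count_add, Multiset.card_cons] at *
    constructor <;> nlinarith

/-- Rounding fixes the number of zeros. If the heads still differed, a letter `x` in excess in `F`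
would occur in `T'` and a letter `y` in excess in `F'` would occur in `T`; sortedness gives `x ≤ y`
and `y ≤ x`, a contradiction. -/
theorem head_eq {F F' : Multiset (Fin 6)} {T T' : Multiset (Multiset (Fin 6))}
    (hF : ∀ V ∈ T, Precedes F V) (hF' : ∀ V ∈ T', Precedes F' V) (hcard : F.card = F'.card)
    (hT : T.card = T'.card) (hsum : (F ::ₘ T).sum = (F' ::ₘ T').sum) : F = F' := by
  have h0 : F.count 0 = F'.count 0 := by
    obtain ⟨h1, h2⟩ := count_head T hF
    obtain ⟨h3, h4⟩ := count_head T' hF'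
    rw [hsum] at h1 h2
    simp only [Multiset.card_cons, hT] at *
    apply le_antisymm
    · by_contra! hlt
      nlinarith
    · by_contra! hlt
      nlinarith
  by_contra hne
  have key : ∀ {F F' : Multiset (Fin 6)}, F.card = F'.card → F ≠ F' →
      ∃ x, F'.count x < F.count x := by
    intro F F' hc hne
    by_contra! hle
    exact hne (Multiset.eq_of_le_of_card_le (Multiset.le_iff_count.2 hle) hc.ge)
  have key' : ∀ {F F' : Multiset (Fin 6)} {T T' : Multiset (Multiset (Fin 6))} {x : Fin 6},
      (F ::ₘ T).sum = (F' ::ₘ T').sum → F'.count x < F.count x →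
      x ∈ F ∧ ∃ V ∈ T', x ∈ V := by
    intro F F' T T' x hs hlt
    have h := congrArg (Multiset.count x) hs
    simp only [Multiset.sum_cons, Multiset.count_add] at h
    refine ⟨Multiset.count_pos.1 (by omega), ?_⟩
    have : x ∈ T'.sum := Multiset.count_pos.1 (by omega)
    exact mem_multiset_sum.1 this
  obtain ⟨x, hx⟩ := key hcard hne
  obtain ⟨y, hy⟩ := key hcard.symm (Ne.symm hne)
  obtain ⟨hxF, V', hV', hxV'⟩ := key' hsum hx
  obtain ⟨hyF, V, hV, hyV⟩ := key' hsum.symm hy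
  have hx0 : x ≠ 0 := by rintro rfl; omega
  have hy0 : y ≠ 0 := by rintro rfl; omega
  have hxy := le_antisymm ((hF V hV).2.2 x hxF y hyV hy0) ((hF' V' hV').2.2 y hyF x hxV' hx0)
  subst hxy
  omega

/-- Reduced monomials are determined by the product of their words. -/
theorem eq_of_sum_eq (hn : 0 < n) (h : IsReduced n S) (h' : IsReduced n S')
    (hsum : S.sum = S'.sum) : S = S' := by
  have hcard : S.card = S'.card :=
    Nat.eq_of_mul_eq_mul_left hn (by rw [← h.card_sum, ← h'.card_sum, hsum])
  induction hk : S.card generalizing S S' with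
  | zero =>
    rw [Multiset.card_eq_zero.1 hk, Multiset.card_eq_zero.1 (hcard.symm.trans hk)]
  | succ k ih =>
    obtain ⟨F, T, rfl, hF⟩ := h.exists_head (by rintro rfl; simp at hk)
    obtain ⟨F', T', rfl, hF'⟩ := h'.exists_head (by rintro rfl; simp [hk] at hcard)
    rw [Multiset.card_cons, Multiset.card_cons, Nat.add_right_cancel_iff] at hcard
    have hFF := head_eq hF hF'
      ((h.card_eq F (by simp)).trans (h'.card_eq F' (by simp)).symm) hcard hsum
    subst hFF
    rw [Multiset.sum_cons, Multiset.sum_cons, add_right_inj] at hsum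
    rw [ih (h.mono (Multiset.le_cons_self _ _)) (h'.mono (Multiset.le_cons_self _ _)) hsum hcard
      (by simpa using hk)]

/-- The product of the words of a reduced monomial is standard. -/
theorem standard_sum (hn : 1 < n) (h : IsReduced n S) : Standard S.sum := by
  rintro ⟨h0, h1, h2⟩
  obtain ⟨V, hV, h0V⟩ := mem_multiset_sum.1 h0
  obtain ⟨P, hP, h1P⟩ := mem_multiset_sum.1 h1
  obtain ⟨Q, hQ, h2Q⟩ := mem_multiset_sum.1 h2
  have hpair : ∀ V ∈ S, ∀ W ∈ S, V ≠ W → ({V, W} : Multiset (Multiset (Fin 6))) ≤ S := by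
    intro V hV W hW hne
    rw [Multiset.le_iff_subset (by simp [hne])]
    intro U hU
    simp only [Multiset.insert_eq_cons, Multiset.mem_cons, Multiset.mem_singleton] at hU
    rcases hU with rfl | rfl <;> assumption
  have hstd : ∀ V ∈ S, ∀ W ∈ S, Standard (V + W) := by
    intro V hV W hW
    rcases eq_or_ne V W with rfl | hne
    · simpa [Standard] using h.standard V hV
    · exact h.standard_add _ _ (hpair V hV W hW hne)
  have h0P : 0 ∉ P := fun h0P => hstd P hP Q hQ (by simp [h0P, h1P, h2Q])
  have hVP : Precedes V P := by
    refine (h.precedes V P (hpair V hV P hP (by rintro rfl; exact h0P h0V))).resolve_right ?_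
    intro hPV
    have := hPV.1
    rw [Multiset.count_eq_zero.2 h0P] at this
    exact absurd (Multiset.count_pos.2 h0V) (by omega)
  -- Since `P` has no 0, `V` has at most one, and `1 < n` leaves room for another letter. Sortedness
  -- against the letter 1 of `P` makes it 1, so `V + Q` contains 0, 1 and 2.
  have hex : ∃ x ∈ V, x ≠ 0 := by
    by_contra! hall
    have h1 := Multiset.count_eq_card.2 fun x hx => (hall x hx).symm
    have h2 := hVP.2.1
    rw [h1, h.card_eq V hV, Multiset.count_eq_zero.2 h0P] at h2
    omega
  obtain ⟨x, hx, hx0⟩ := hex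
  have hx1 : x = 1 := by
    have := hVP.2.2 x hx 1 h1P (by decide)
    omega
  subst hx1
  exact hstd V hV Q hQ (by simp [h0V, hx, h2Q])

end IsReduced

/-! ### Weights of words -/

/-- The sum of the letters of a word. -/
def letterSum (U : Multiset (Fin 6)) : ℕ := (U.map Fin.val).sum

theorem letterSum_add (U V : Multiset (Fin 6)) :
    letterSum (U + V) = letterSum U + letterSum V := by
  simp [letterSum]

theorem letterSum_le (U : Multiset (Fin 6)) : letterSum U ≤ 5 * U.card := by
  have := Multiset.sum_le_card_nsmul (U.map Fin.val) 5 (by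
    intro x hx
    obtain ⟨j, -, rfl⟩ := Multiset.mem_map.1 hx
    omega)
  rw [Multiset.card_map, smul_eq_mul] at this
  unfold letterSum
  omega

theorem letterSum_lt_of_forall_lt {X Y : Multiset (Fin 6)} (hc : X.card = Y.card) (hX : X ≠ 0)
    (hXY : ∀ x ∈ X, ∀ y ∈ Y, x < y) : letterSum X < letterSum Y := by
  unfold letterSum
  obtain ⟨M, hM, hmax⟩ := X.toFinset.exists_max_image Fin.val
    (by simpa [Finset.nonempty_iff_ne_empty] using hX)
  have h1 := Multiset.sum_le_card_nsmul (X.map Fin.val) M.val (by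
    intro x hx
    obtain ⟨j, hj, rfl⟩ := Multiset.mem_map.1 hx
    exact hmax j (by simpa using hj))
  have h2 := Multiset.card_nsmul_le_sum (s := Y.map Fin.val) (a := M.val + 1) (by
    intro y hy
    obtain ⟨j, hj, rfl⟩ := Multiset.mem_map.1 hy
    exact hXY M (by simpa using hM) j hj)
  rw [Multiset.card_map, smul_eq_mul] at h1 h2
  have := Multiset.card_pos.2 hX
  rw [← hc, mul_add, mul_one] at h2
  omega

/-- Among the factors of `F + T` with the same number of letters, the first word of a sorted pair
has the least letter sum. -/
theorem Precedes.letterSum_lt {F T G : Multiset (Fin 6)} (h : Precedes F T) (hG : G ≤ F + T)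
    (hc : G.card = F.card) (h0 : G.count 0 ≤ F.count 0) (hne : G ≠ F) :
    letterSum F < letterSum G := by
  have hF : F = F ∩ G + (F - G) := by
    ext x
    simp only [Multiset.count_add, Multiset.count_inter, Multiset.count_sub]
    omega
  have hG' : G = F ∩ G + (G - F) := by
    ext x
    simp only [Multiset.count_add, Multiset.count_inter, Multiset.count_sub]
    omega
  have hcard : (F - G).card = (G - F).card := by
    have h1 := congrArg Multiset.card hF
    have h2 := congrArg Multiset.card hG'
    rw [Multiset.card_add] at h1 h2
    omega
  -- The excess of `G` over `F` consists of nonzero letters of `T`, hence dominates the letters of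
  -- `F`; strictness holds because the two differences share no letter.
  have hlt : letterSum (F - G) < letterSum (G - F) := by
    refine letterSum_lt_of_forall_lt hcard ?_ ?_
    · intro h0
      exact hne (Multiset.eq_of_le_of_card_le (tsub_eq_zero_iff_le.1 h0) hc.le).symm
    · intro x hx y hy
      rw [← Multiset.count_pos, Multiset.count_sub] at hx hy
      have hy' := Multiset.le_iff_count.1 hG y
      rw [Multiset.count_add] at hy'
      have hy0 : y ≠ 0 := by rintro rfl; omega
      refine lt_of_le_of_ne (h.2.2 x (Multiset.count_pos.1 (by omega)) y
        (Multiset.count_pos.1 (by omega)) hy0) ?_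
      rintro rfl
      omega
  have e1 := congrArg letterSum hF
  have e2 := congrArg letterSum hG'
  rw [letterSum_add] at e1 e2
  omega

/-- The weight of a word of length `n`. -/
def wordWeight (n : ℕ) (U : Multiset (Fin 6)) : ℕ :=
  (2 * (50 * n ^ 2 + 1) * n ^ 2 + 50 * n ^ 2 + 1) * headCount U +
    (50 * n ^ 2 + 1) * U.count 0 ^ 2 + (25 * n ^ 2 - letterSum U ^ 2)

/-- The coefficients separate the tiers: for a pair of words the last tier is at most `50 * n ^ 2`,
and the last two together are less than the coefficient of `headCount`. Since letter sums are at
most `5 * n`, the subtraction in the weight never truncates. -/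
theorem wordWeight_bounds {n : ℕ} {U : Multiset (Fin 6)} (hU : U.card = n) :
    (2 * (50 * n ^ 2 + 1) * n ^ 2 + 50 * n ^ 2 + 1) * headCount U ≤ wordWeight n U ∧
    wordWeight n U ≤ (2 * (50 * n ^ 2 + 1) * n ^ 2 + 50 * n ^ 2 + 1) * headCount U +
      (50 * n ^ 2 + 1) * n ^ 2 + 25 * n ^ 2 := by
  have h1 : U.count 0 ^ 2 ≤ n ^ 2 :=
    Nat.pow_le_pow_left (by rw [← hU]; exact Multiset.count_le_card _ _) 2
  have h2 := Nat.mul_le_mul_left (50 * n ^ 2 + 1) h1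
  unfold wordWeight
  constructor <;> omega

theorem wordWeight_lt_of_headCount_lt {n : ℕ} {V₁ V₂ V₃ V₄ : Multiset (Fin 6)}
    (h₁ : V₁.card = n) (h₂ : V₂.card = n) (h₃ : V₃.card = n) (h₄ : V₄.card = n)
    (h : headCount V₃ + headCount V₄ < headCount V₁ + headCount V₂) :
    wordWeight n V₃ + wordWeight n V₄ < wordWeight n V₁ + wordWeight n V₂ := by
  have b₁ := (wordWeight_bounds h₁).1
  have b₂ := (wordWeight_bounds h₂).1
  have b₃ := (wordWeight_bounds h₃).2
  have b₄ := (wordWeight_bounds h₄).2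
  generalize hA : 2 * (50 * n ^ 2 + 1) * n ^ 2 + 50 * n ^ 2 + 1 = A at *
  have := Nat.mul_le_mul_left A (Nat.succ_le_of_lt h)
  rw [Nat.succ_eq_add_one, mul_add, mul_add, mul_add, mul_one] at this
  rw [mul_assoc] at hA
  omega

/-- Sorting a pair of words decreases the weight. -/
theorem Precedes.wordWeight_lt {n : ℕ} {V₁ V₂ V₃ V₄ : Multiset (Fin 6)} (h : Precedes V₃ V₄)
    (h₁ : V₁.card = n) (h₂ : V₂.card = n) (h₃ : V₃.card = n) (h₄ : V₄.card = n)
    (hsum : V₃ + V₄ = V₁ + V₂) (hne : V₁ ≠ V₃) (hne' : V₂ ≠ V₃) :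
    wordWeight n V₃ + wordWeight n V₄ < wordWeight n V₁ + wordWeight n V₂ := by
  wlog hle : V₂.count 0 ≤ V₁.count 0 generalizing V₁ V₂
  · rw [add_comm (wordWeight n V₁)]
    exact this h₂ h₁ (hsum.trans (add_comm _ _)) hne' hne (by omega)
  have hhead : headCount V₃ + headCount V₄ = headCount V₁ + headCount V₂ := by
    rw [← headCount_add, ← headCount_add, hsum]
  have hzero : V₃.count 0 + V₄.count 0 = V₁.count 0 + V₂.count 0 := by
    rw [← Multiset.count_add, ← Multiset.count_add, hsum]
  have hlet : letterSum V₃ + letterSum V₄ = letterSum V₁ + letterSum V₂ := by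
    rw [← letterSum_add, ← letterSum_add, hsum]
  obtain ⟨hz1, hz2, -⟩ := id h
  have hb : ∀ {V : Multiset (Fin 6)}, V.card = n → letterSum V ^ 2 ≤ 25 * n ^ 2 := by
    intro V hV
    have := Nat.pow_le_pow_left (letterSum_le V) 2
    rw [hV] at this
    linarith
  have b₁ := hb h₁
  have b₂ := hb h₂
  have b₃ := hb h₃
  have b₄ := hb h₄
  have hA := congrArg (fun k => (2 * (50 * n ^ 2 + 1) * n ^ 2 + 50 * n ^ 2 + 1) * k) hhead
  simp only [mul_add] at hA
  unfold wordWeight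
  -- Zeros are balanced in `V₃`, `V₄`, so the word with more zeros among `V₁`, `V₂` has at least as
  -- many as `V₃`; a tie is decided by the letter sums.
  rcases Nat.eq_or_lt_of_le (show V₃.count 0 ≤ V₁.count 0 by omega) with heq | hlt
  · have heq' : V₄.count 0 = V₂.count 0 := by omega
    have s₁ := h.letterSum_lt (G := V₁) (hsum ▸ Multiset.le_add_right _ _) (h₁.trans h₃.symm)
      heq.ge hne
    have s₂ := h.letterSum_lt (G := V₂) (hsum ▸ Multiset.le_add_left _ _) (h₂.trans h₃.symm)
      (by omega) hne'
    -- The total is fixed and `V₃` has the strictly least letter sum, so those of `V₁`, `V₂` lie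
    -- strictly between those of `V₃` and `V₄`.
    have hsq : letterSum V₁ ^ 2 + letterSum V₂ ^ 2 < letterSum V₃ ^ 2 + letterSum V₄ ^ 2 := by
      obtain ⟨p, hp⟩ := Nat.exists_eq_add_of_lt s₁
      obtain ⟨q, hq⟩ := Nat.exists_eq_add_of_lt s₂
      have h4 : letterSum V₄ = letterSum V₃ + (p + 1) + (q + 1) := by omega
      rw [hp, hq, h4]
      nlinarith
    rw [heq, heq']
    simp only [mul_add] at *
    omega
  · have hsq : V₃.count 0 ^ 2 + V₄.count 0 ^ 2 + 1 ≤ V₁.count 0 ^ 2 + V₂.count 0 ^ 2 := by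
      obtain ⟨p, hp⟩ := Nat.exists_eq_add_of_lt hlt
      have h4 : V₄.count 0 = V₂.count 0 + (p + 1) := by omega
      rw [hp, h4]
      nlinarith
    have := Nat.mul_le_mul_left (50 * n ^ 2 + 1) hsq
    simp only [mul_add, mul_one] at *
    omega

/-! ### The two kinds of binomials -/

theorem mem_tail_pos {L : List (Fin 6)} (hL : L.Pairwise (· ≤ ·))
    (h1 : ∀ j, L[1]? = some j → 0 < j) : ∀ y ∈ L.tail, y ≠ 0 := by
  match L, hL, h1 with
  | [], _, _ => simp
  | [_], _, _ => simp
  | c :: d :: t, hL, h1 =>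
    have hd : 0 < d := h1 d (by simp)
    intro y hy
    rw [List.tail_cons, List.mem_cons] at hy
    rcases hy with rfl | hy
    · exact hd.ne'
    · exact (lt_of_lt_of_le hd ((List.pairwise_cons.1 (List.pairwise_cons.1 hL).2).1 y hy)).ne'

theorem IsTypeTwo.add_eq_and_precedes {n : ℕ} {W₁ W₂ W₃ W₄ : Sym (Fin 6) n}
    (h : IsTypeTwo W₁ W₂ W₃ W₄) :
    (W₃ : Multiset (Fin 6)) + (W₄ : Multiset (Fin 6)) =
        (W₁ : Multiset (Fin 6)) + (W₂ : Multiset (Fin 6)) ∧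
      Precedes (W₃ : Multiset (Fin 6)) W₄ := by
  obtain ⟨α, L₁, L₂, hα, hL₁, hL₂, hsort, hpos, h₃, h₄⟩ := h
  have hsum := congrArg (fun l : List (Fin 6) => (l : Multiset (Fin 6))) hsort
  simp only [Multiset.sort_eq] at hsum
  have hs := Multiset.pairwise_sort ((W₁ : Multiset (Fin 6)) + (W₂ : Multiset (Fin 6))) (· ≤ ·)
  rw [hsort] at hs
  have hL : (L₁ ++ L₂).Pairwise (· ≤ ·) := (List.pairwise_append.1 hs).2.1
  have htail := mem_tail_pos hL hpos
  have hle := (List.pairwise_append.1 hL).2.2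
  constructor
  · rw [h₃, h₄, hsum]
    simp only [← Multiset.coe_add, two_mul, ← List.replicate_append_replicate]
    abel
  -- Only the first letter of `L₁` can still be 0: this is the surplus 1 when their number is odd.
  · have hc : L₁.count 0 ≤ 1 ∧ L₂.count 0 = 0 := by
      rcases L₁ with _ | ⟨c, t⟩
      · obtain rfl : L₂ = [] := List.length_eq_zero_iff.1 (by rw [hL₂, ← hL₁]; rfl)
        simp
      · have h1 : t.count 0 = 0 := List.count_eq_zero.2 fun h0 => htail 0 (by simp [h0]) rfl
        have h2 : L₂.count 0 = 0 := List.count_eq_zero.2 fun h0 => htail 0 (by simp [h0]) rfl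
        refine ⟨?_, h2⟩
        rw [List.count_cons, h1]
        split <;> omega
    refine ⟨?_, ?_, fun x hx y hy hy0 => ?_⟩
    · rw [h₃, h₄]
      simp [hc.2]
    · rw [h₃, h₄]
      simp [hc.1, hc.2]
    · rw [h₃, Multiset.mem_coe, List.mem_append] at hx
      rw [h₄, Multiset.mem_coe, List.mem_append] at hy
      rcases hy with hy | hy
      · exact absurd (List.eq_of_mem_replicate hy) hy0
      rcases hx with hx | hx
      · rw [List.eq_of_mem_replicate hx]
        exact Fin.zero_le y
      · exact hle x hx y hy

theorem sort_eq_replicate_append (U : Multiset (Fin 6)) :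
    U.sort (· ≤ ·) =
      List.replicate (U.count 0) 0 ++ (U.filter (· ≠ 0)).sort (· ≤ ·) := by
  refine List.Perm.eq_of_pairwise' (r := (· ≤ ·)) (Multiset.pairwise_sort _ _) ?_ ?_
  · rw [List.pairwise_append]
    refine ⟨by simp [List.pairwise_replicate], Multiset.pairwise_sort _ _, ?_⟩
    intro x hx y _
    rw [List.eq_of_mem_replicate hx]
    exact Fin.zero_le y
  · rw [← Multiset.coe_eq_coe, ← Multiset.coe_add, Multiset.sort_eq, Multiset.sort_eq,
      Multiset.coe_replicate, ← Multiset.filter_eq' U 0]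
    exact (Multiset.filter_add_not _ _).symm

theorem exists_isTypeTwo {n : ℕ} (W₁ W₂ : Sym (Fin 6) n) :
    ∃ W₃ W₄ : Sym (Fin 6) n, IsTypeTwo W₁ W₂ W₃ W₄ := by
  set U := (W₁ : Multiset (Fin 6)) + (W₂ : Multiset (Fin 6)) with hU
  have hcard : U.card = 2 * n := by
    rw [hU, Multiset.card_add, Sym.card_coe, Sym.card_coe]
    ring
  obtain ⟨k, L, hL, hpos⟩ : ∃ (k : ℕ) (L : List (Fin 6)),
      U.sort (· ≤ ·) = List.replicate (2 * k) 0 ++ L ∧ ∀ j, L[1]? = some j → 0 < j := by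
    set R := (U.filter (· ≠ 0)).sort (· ≤ ·) with hR
    have hRpos : ∀ j ∈ R, 0 < j := by
      intro j hj
      rw [hR, Multiset.mem_sort, Multiset.mem_filter] at hj
      exact Fin.pos_of_ne_zero hj.2
    rcases Nat.even_or_odd' (U.count 0) with ⟨k, hk | hk⟩
    · refine ⟨k, R, by rw [sort_eq_replicate_append, hk], fun j hj => ?_⟩
      exact hRpos j (List.mem_of_getElem? hj)
    -- With an odd number of zeros, one is left as the first letter of the list, which the condition
    -- on index 1 permits.
    · refine ⟨k, 0 :: R, ?_, fun j hj => ?_⟩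
      · rw [sort_eq_replicate_append, hk, List.replicate_succ']
        simp [hR]
      · rw [List.getElem?_cons_succ] at hj
        exact hRpos j (List.mem_of_getElem? hj)
  have hlen := congrArg List.length hL
  rw [Multiset.length_sort, hcard, List.length_append, List.length_replicate] at hlen
  have h₁ : (L.take (n - k)).length = n - k := by rw [List.length_take]; omega
  have h₂ : (L.drop (n - k)).length = n - k := by rw [List.length_drop]; omega
  have hk : n - (n - k) = k := by omega
  refine ⟨⟨((List.replicate k 0 ++ L.take (n - k) : List (Fin 6)) : Multiset (Fin 6)), ?_⟩,
    ⟨((List.replicate k 0 ++ L.drop (n - k) : List (Fin 6)) : Multiset (Fin 6)), ?_⟩,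
    n - k, L.take (n - k), L.drop (n - k), Nat.sub_le _ _, h₁, h₂, ?_, ?_, ?_, ?_⟩
  · rw [Multiset.coe_card, List.length_append, List.length_replicate, h₁]
    omega
  · rw [Multiset.coe_card, List.length_append, List.length_replicate, h₂]
    omega
  · rw [hk, List.take_append_drop, ← hU, hL]
  · rwa [List.take_append_drop]
  · rw [hk]
    rfl
  · rw [hk]
    rfl

theorem triple_eq_of_set_eq {i j k p q r : Fin 6}
    (h : ({i, j, k} : Set (Fin 6)) = {p, q, r}) (hpqr : p ≠ q ∧ p ≠ r ∧ q ≠ r) :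
    ({i, j, k} : Multiset (Fin 6)) = {p, q, r} := by
  have h' : ({i, j, k} : Finset (Fin 6)) = {p, q, r} := by
    apply Finset.coe_injective
    simpa using h
  have hle : ({p, q, r} : Multiset (Fin 6)) ≤ {i, j, k} := by
    rw [Multiset.le_iff_subset (by simp [hpqr])]
    intro y hy
    have : y ∈ ({p, q, r} : Finset (Fin 6)) := by simpa using hy
    rw [← h'] at this
    simpa using this
  exact (Multiset.eq_of_le_of_card_le hle (by simp)).symm

theorem IsTypeOne.exists_add {n : ℕ} {W₁ W₂ W₃ W₄ : Sym (Fin 6) n}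
    (h : IsTypeOne W₁ W₂ W₃ W₄) : ∃ T : Multiset (Fin 6),
      (W₁ : Multiset (Fin 6)) + (W₂ : Multiset (Fin 6)) = {0, 1, 2} + T ∧
      (W₃ : Multiset (Fin 6)) + (W₄ : Multiset (Fin 6)) = {3, 4, 5} + T := by
  obtain ⟨j₁, j₂, j₃, j₄, j₅, j₆, M₁, M₂, h123, h456, h₁, h₂, h₃, h₄⟩ := h
  refine ⟨M₁ + M₂, ?_, ?_⟩
  · rw [h₁, h₂, ← triple_eq_of_set_eq h123 (by decide)]
    simp only [Multiset.insert_eq_cons, ← Multiset.singleton_add]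
    abel
  · rw [h₃, h₄, ← triple_eq_of_set_eq h456 (by decide)]
    simp only [Multiset.insert_eq_cons, ← Multiset.singleton_add]
    abel

theorem IsTypeOne.cong {n : ℕ} {W₁ W₂ W₃ W₄ : Sym (Fin 6) n} (h : IsTypeOne W₁ W₂ W₃ W₄) :
    Cong ((W₁ : Multiset (Fin 6)) + (W₂ : Multiset (Fin 6)))
      ((W₃ : Multiset (Fin 6)) + (W₄ : Multiset (Fin 6))) := by
  obtain ⟨T, h₁, h₂⟩ := h.exists_add
  rw [h₁, h₂]
  exact cong_insert T

theorem IsTypeOne.headCount_lt {n : ℕ} {W₁ W₂ W₃ W₄ : Sym (Fin 6) n}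
    (h : IsTypeOne W₁ W₂ W₃ W₄) :
    headCount (W₃ : Multiset (Fin 6)) + headCount (W₄ : Multiset (Fin 6)) <
      headCount (W₁ : Multiset (Fin 6)) + headCount (W₂ : Multiset (Fin 6)) := by
  obtain ⟨T, h₁, h₂⟩ := h.exists_add
  rw [← headCount_add, ← headCount_add, h₁, h₂, headCount_add, headCount_add,
    show headCount {0, 1, 2} = 3 from rfl, show headCount {3, 4, 5} = 0 from rfl]
  omega

theorem exists_isTypeOne_of_mem {n : ℕ} {W₁ W₂ : Sym (Fin 6) n} {j₁ j₂ j₃ : Fin 6}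
    (hset : ({j₁, j₂, j₃} : Set (Fin 6)) = {0, 1, 2}) (hne : j₁ ≠ j₂)
    (h₁ : j₁ ∈ (W₁ : Multiset (Fin 6))) (h₂ : j₂ ∈ (W₁ : Multiset (Fin 6)))
    (h₃ : j₃ ∈ (W₂ : Multiset (Fin 6))) : ∃ W₃ W₄, IsTypeOne W₁ W₂ W₃ W₄ := by
  obtain ⟨M, hM⟩ := Multiset.exists_cons_of_mem h₁
  rw [hM, Multiset.mem_cons] at h₂
  obtain ⟨M₁, rfl⟩ := Multiset.exists_cons_of_mem (h₂.resolve_left hne.symm)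
  obtain ⟨M₂, hM₂⟩ := Multiset.exists_cons_of_mem h₃
  have c₁ := W₁.2
  have c₂ := W₂.2
  change (W₁ : Multiset (Fin 6)).card = n at c₁
  change (W₂ : Multiset (Fin 6)).card = n at c₂
  rw [hM, Multiset.card_cons, Multiset.card_cons] at c₁
  rw [hM₂, Multiset.card_cons] at c₂
  exact ⟨⟨3 ::ₘ 4 ::ₘ M₁, by simpa using c₁⟩, ⟨5 ::ₘ M₂, by simpa using c₂⟩,
    j₁, j₂, j₃, 3, 4, 5, M₁, M₂, hset, rfl, hM, hM₂, rfl, rfl⟩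

/-- Neither word contains all three letters, so one of them contains exactly two in the chosen
splitting and takes the role of `j₁ j₂ M₁`; hence the possible swap. -/
theorem exists_isTypeOne {n : ℕ} {W₁ W₂ : Sym (Fin 6) n} (h₁ : IsStandard W₁)
    (h₂ : IsStandard W₂)
    (h : ¬ Standard ((W₁ : Multiset (Fin 6)) + (W₂ : Multiset (Fin 6)))) :
    (∃ W₃ W₄, IsTypeOne W₁ W₂ W₃ W₄) ∨ ∃ W₃ W₄, IsTypeOne W₂ W₁ W₃ W₄ := by
  have e1 : ({0, 2, 1} : Set (Fin 6)) = {0, 1, 2} := by ext; simp; tauto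
  have e2 : ({1, 2, 0} : Set (Fin 6)) = {0, 1, 2} := by ext; simp; tauto
  change ¬ (0 ∈ (W₁ : Multiset (Fin 6)) ∧ 1 ∈ (W₁ : Multiset (Fin 6)) ∧
    2 ∈ (W₁ : Multiset (Fin 6))) at h₁
  change ¬ (0 ∈ (W₂ : Multiset (Fin 6)) ∧ 1 ∈ (W₂ : Multiset (Fin 6)) ∧
    2 ∈ (W₂ : Multiset (Fin 6))) at h₂
  rw [Standard, not_not] at h
  simp only [Multiset.mem_add] at h
  obtain ⟨h0 | h0, h1 | h1, h2 | h2⟩ := h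
  · exact absurd ⟨h0, h1, h2⟩ h₁
  · exact Or.inl (exists_isTypeOne_of_mem rfl (by decide) h0 h1 h2)
  · exact Or.inl (exists_isTypeOne_of_mem e1 (by decide) h0 h2 h1)
  · exact Or.inr (exists_isTypeOne_of_mem e2 (by decide) h1 h2 h0)
  · exact Or.inl (exists_isTypeOne_of_mem e2 (by decide) h1 h2 h0)
  · exact Or.inr (exists_isTypeOne_of_mem e1 (by decide) h0 h2 h1)
  · exact Or.inr (exists_isTypeOne_of_mem rfl (by decide) h0 h1 h2)
  · exact absurd ⟨h0, h1, h2⟩ h₂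

/-! ### The quadratic Gröbner basis -/

section Groebner

variable (K : Type*) [Field K] {ι τ : Type} {n : ℕ}

/-- The nonzero binomials of the two kinds in variables labelled by words. -/
def labelledBinomials (x : Sym (Fin 6) n → ι) : Set (MvPolynomial ι K) :=
  {g | g ≠ 0 ∧ ∃ W₁ W₂ W₃ W₄ : Sym (Fin 6) n,
    IsAdmissible W₁ W₂ W₃ W₄ ∧ g = X (x W₁) * X (x W₂) - X (x W₃) * X (x W₄)}

variable {K}

theorem X_mul_X_eq (i j : ι) :
    (X i * X j : MvPolynomial ι K) = monomial (Finsupp.single i 1 + Finsupp.single j 1) 1 := by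
  rw [X, X, monomial_mul, one_mul]

theorem multiset_pair_eq {α : Type*} {p q r s : α} (h : ({p, q} : Multiset α) = {r, s}) :
    (p = r ∧ q = s) ∨ (p = s ∧ q = r) := by
  rw [Multiset.insert_eq_cons, Multiset.insert_eq_cons, Multiset.cons_eq_cons] at h
  rcases h with ⟨h1, h2⟩ | ⟨-, t, h1, h2⟩
  · exact Or.inl ⟨h1, Multiset.singleton_inj.1 h2⟩
  · obtain ⟨rfl, -⟩ := (Multiset.singleton_eq_cons_iff _).1 h1
    obtain ⟨rfl, -⟩ := (Multiset.singleton_eq_cons_iff _).1 h2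
    exact Or.inr ⟨rfl, rfl⟩

theorem linearCombination_eq_sum {ι τ : Type*} (a : ι → τ →₀ ℕ) (d : ι →₀ ℕ) :
    Finsupp.linearCombination ℕ a d = ((Finsupp.toMultiset d).map a).sum := by
  classical
  induction d using Finsupp.induction_linear with
  | zero => simp
  | add f g hf hg => rw [map_add, map_add, Multiset.map_add, Multiset.sum_add, hf, hg]
  | single i k =>
    rw [Finsupp.linearCombination_single, Finsupp.toMultiset_single, Multiset.map_nsmul,
      Multiset.map_singleton, Multiset.sum_nsmul, Multiset.sum_singleton]

/-- All that is kept of the configuration is `hb`, together with a labelling of the variables by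
words; this covers both nested configurations and the dilated Birkhoff polytopes. -/
theorem exists_quadraticGroebnerBasis [Finite ι] (hn : 1 < n) (a : ι → τ →₀ ℕ)
    (ha : Function.Injective a) (b : Fin 6 → τ →₀ ℕ) (x : Sym (Fin 6) n → ι)
    (hx : Function.Surjective x)
    (hax : ∀ W, a (x W) = ((W : Multiset (Fin 6)).map b).sum)
    (hb : ∀ U V : Multiset (Fin 6), (U.map b).sum = (V.map b).sum ↔ Cong U V) :
    ∃ ord : MonomialOrder.{0, 0} ι,
      IsQuadraticGroebnerBasis ord (toricIdealOfFamily K a) (labelledBinomials K x) ∧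
      ∀ W₁ W₂ W₃ W₄ : Sym (Fin 6) n, IsAdmissible W₁ W₂ W₃ W₄ →
        (X (x W₁) * X (x W₂) - X (x W₃) * X (x W₄) : MvPolynomial ι K) ≠ 0 →
        ord.degree (X (x W₁) * X (x W₂) - X (x W₃) * X (x W₄) : MvPolynomial ι K) =
          Finsupp.single (x W₁) 1 + Finsupp.single (x W₂) 1 := by
  classical
  have hcong : ∀ W W' : Sym (Fin 6) n,
      x W = x W' ↔ Cong (W : Multiset (Fin 6)) (W' : Multiset (Fin 6)) := by
    intro W W'
    rw [← ha.eq_iff, hax, hax, hb]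
  have hrep : ∀ i, ∃ W : Sym (Fin 6) n, x W = i ∧ Standard (W : Multiset (Fin 6)) := by
    intro i
    obtain ⟨W, rfl⟩ := hx i
    obtain ⟨V, hV, hc⟩ := exists_standard (W : Multiset (Fin 6))
    exact ⟨⟨V, hc.card_eq.symm.trans W.2⟩, (hcong _ _).2 hc.symm, hV⟩
  choose rep hxrep hstd using hrep
  have hcongrep : ∀ W : Sym (Fin 6) n,
      Cong (W : Multiset (Fin 6)) (rep (x W) : Multiset (Fin 6)) := fun W =>
    (hcong _ _).1 (hxrep (x W)).symm
  have hrepx : ∀ W : Sym (Fin 6) n, Standard (W : Multiset (Fin 6)) → rep (x W) = W :=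
    fun W hW => Sym.coe_injective ((hcongrep W).eq_of_standard hW (hstd _)).symm
  -- A variable may have several words, so its weight is read off its standard word.
  let wt : ι → ℕ := fun i => wordWeight n (rep i : Multiset (Fin 6))
  have hwt : ∀ W₁ W₂ W₃ W₄ : Sym (Fin 6) n, IsAdmissible W₁ W₂ W₃ W₄ →
      (X (x W₁) * X (x W₂) - X (x W₃) * X (x W₄) : MvPolynomial ι K) ≠ 0 →
      wt (x W₃) + wt (x W₄) < wt (x W₁) + wt (x W₂) := by
    rintro W₁ W₂ W₃ W₄ ⟨hs₁, hs₂, h⟩ hne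
    have h3 := (hcongrep W₃).headCount_le (hstd _)
    have h4 := (hcongrep W₄).headCount_le (hstd _)
    have hlt : headCount (rep (x W₃) : Multiset (Fin 6)) +
        headCount (rep (x W₄) : Multiset (Fin 6)) <
        headCount (W₁ : Multiset (Fin 6)) + headCount (W₂ : Multiset (Fin 6)) →
        wt (x W₃) + wt (x W₄) < wt (x W₁) + wt (x W₂) := by
      intro hlt
      refine wordWeight_lt_of_headCount_lt (rep _).2 (rep _).2 (rep _).2 (rep _).2 ?_
      rwa [hrepx W₁ hs₁, hrepx W₂ hs₂]
    rcases h with h | h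
    · exact hlt (by have := h.headCount_lt; omega)
    · obtain ⟨hsum, hprec⟩ := h.add_eq_and_precedes
      have hhead := congrArg headCount hsum
      rw [headCount_add, headCount_add] at hhead
      -- The sorted words `W₃`, `W₄` need not be standard. If one is not, standardizing strictly
      -- lowers the head count and the top tier decides.
      by_cases he : headCount (rep (x W₃) : Multiset (Fin 6)) = headCount (W₃ : Multiset (Fin 6)) ∧
          headCount (rep (x W₄) : Multiset (Fin 6)) = headCount (W₄ : Multiset (Fin 6))
      · have e3 := h3.2 he.1
        have e4 := h4.2 he.2
        simp only [wt]
        rw [e3, e4, hrepx W₁ hs₁, hrepx W₂ hs₂]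
        refine hprec.wordWeight_lt W₁.2 W₂.2 W₃.2 W₄.2 hsum ?_ ?_
        · intro h13
          apply hne
          rw [← h13, add_right_inj] at hsum
          rw [Sym.coe_injective h13, Sym.coe_injective hsum, sub_self]
        · intro h23
          apply hne
          rw [← h23, add_comm, add_left_inj] at hsum
          rw [Sym.coe_injective h23, Sym.coe_injective hsum, mul_comm, sub_self]
      · exact hlt (by omega)
  -- The weights already decide every binomial, so any order of the variables serves to break ties.
  let _ : LinearOrder ι := linearOrderOfSTO WellOrderingRel
  have hord : ∀ W₁ W₂ W₃ W₄ : Sym (Fin 6) n, IsAdmissible W₁ W₂ W₃ W₄ →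
      (X (x W₁) * X (x W₂) - X (x W₃) * X (x W₄) : MvPolynomial ι K) ≠ 0 →
      (weightLex wt).toSyn (Finsupp.single (x W₃) 1 + Finsupp.single (x W₄) 1) <
        (weightLex wt).toSyn (Finsupp.single (x W₁) 1 + Finsupp.single (x W₂) 1) := by
    intro W₁ W₂ W₃ W₄ h hne
    apply weightLex_lt
    simpa using hwt W₁ W₂ W₃ W₄ h hne
  have hdeg : ∀ W₁ W₂ W₃ W₄ : Sym (Fin 6) n, IsAdmissible W₁ W₂ W₃ W₄ →
      (X (x W₁) * X (x W₂) - X (x W₃) * X (x W₄) : MvPolynomial ι K) ≠ 0 →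
      (weightLex wt).degree (X (x W₁) * X (x W₂) - X (x W₃) * X (x W₄) : MvPolynomial ι K) =
        Finsupp.single (x W₁) 1 + Finsupp.single (x W₂) 1 := by
    intro W₁ W₂ W₃ W₄ h hne
    have := hord W₁ W₂ W₃ W₄ h hne
    rw [X_mul_X_eq, X_mul_X_eq, degree_monomial_sub_monomial _ this]
  have himage : ∀ W₁ W₂ W₃ W₄ : Sym (Fin 6) n, IsAdmissible W₁ W₂ W₃ W₄ →
      a (x W₁) + a (x W₂) = a (x W₃) + a (x W₄) := by
    rintro W₁ W₂ W₃ W₄ ⟨-, -, h⟩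
    simp only [hax, ← Multiset.sum_add, ← Multiset.map_add]
    rw [hb]
    rcases h with h | h
    · exact h.cong
    · rw [h.add_eq_and_precedes.1]
      exact Cong.refl _
  have hrepinj : Function.Injective fun i => (rep i : Multiset (Fin 6)) := by
    intro i j hij
    rw [← hxrep i, ← hxrep j, Sym.coe_injective hij]
  let words : (ι →₀ ℕ) → Multiset (Multiset (Fin 6)) := fun d =>
    (Finsupp.toMultiset d).map fun i => (rep i : Multiset (Fin 6))
  have hred : ∀ d : ι →₀ ℕ, (∀ g ∈ labelledBinomials K x, ¬ (weightLex wt).degree g ≤ d) →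
      IsReduced n (words d) := by
    intro d hd
    -- No initial monomial divides `d`, so every admissible binomial starting from a pair of its
    -- variables vanishes.
    have hnot : ∀ i j, ({i, j} : Multiset ι) ≤ Finsupp.toMultiset d → ∀ W₃ W₄,
        IsAdmissible (rep i) (rep j) W₃ W₄ ∨ IsAdmissible (rep j) (rep i) W₃ W₄ →
        (X i * X j - X (x W₃) * X (x W₄) : MvPolynomial ι K) = 0 := by
      intro i j hij W₃ W₄ hadm
      have hle : Finsupp.single i 1 + Finsupp.single j 1 ≤ d := by
        rw [← Finsupp.orderIsoMultiset.le_iff_le, Finsupp.coe_orderIsoMultiset]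
        simpa using hij
      by_contra hne
      rcases hadm with hadm | hadm
      · refine hd _ ⟨hne, _, _, _, _, hadm, by rw [hxrep, hxrep]⟩ ?_
        have := hdeg _ _ _ _ hadm (by rwa [hxrep, hxrep])
        rw [hxrep, hxrep] at this
        rwa [this]
      · rw [mul_comm (X i)] at hne
        refine hd _ ⟨hne, _, _, _, _, hadm, by rw [hxrep, hxrep]⟩ ?_
        have := hdeg _ _ _ _ hadm (by rwa [hxrep, hxrep])
        rw [hxrep, hxrep] at this
        rwa [this, add_comm]
    have hpair : ∀ V W, ({V, W} : Multiset (Multiset (Fin 6))) ≤ words d →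
        ∃ i j, V = rep i ∧ W = rep j ∧ ({i, j} : Multiset ι) ≤ Finsupp.toMultiset d := by
      intro V W hVW
      obtain ⟨i, -, rfl⟩ := Multiset.mem_map.1 (Multiset.mem_of_le hVW (by simp : V ∈ _))
      obtain ⟨j, -, rfl⟩ := Multiset.mem_map.1 (Multiset.mem_of_le hVW (by simp : W ∈ _))
      exact ⟨i, j, rfl, rfl, (Multiset.map_le_map_iff hrepinj).1 (by simpa using hVW)⟩
    have hmono : ∀ p q r s : ι, (X p * X q - X r * X s : MvPolynomial ι K) = 0 →
        ({p, q} : Multiset ι) = {r, s} := by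
      intro p q r s h
      rw [X_mul_X_eq, X_mul_X_eq, sub_eq_zero] at h
      have := congrArg Finsupp.toMultiset (monomial_left_injective one_ne_zero h)
      simpa using this
    have hsa : ∀ V W, ({V, W} : Multiset (Multiset (Fin 6))) ≤ words d → Standard (V + W) := by
      intro V W hVW
      obtain ⟨i, j, rfl, rfl, hij⟩ := hpair V W hVW
      by_contra hns
      -- A binomial of the first kind never vanishes, because the head count drops.
      have hlt : ∀ {p q : ι} {W₃ W₄ : Sym (Fin 6) n}, IsTypeOne (rep p) (rep q) W₃ W₄ →
          ({p, q} : Multiset ι) ≠ {x W₃, x W₄} := by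
        intro p q W₃ W₄ h he
        have h3 := ((hcongrep W₃).headCount_le (hstd _)).1
        have h4 := ((hcongrep W₄).headCount_le (hstd _)).1
        have := congrArg (fun s => (s.map fun i => headCount (rep i : Multiset (Fin 6))).sum) he
        simp at this
        have := h.headCount_lt
        omega
      rcases exists_isTypeOne (hstd i) (hstd j) hns with ⟨W₃, W₄, h⟩ | ⟨W₃, W₄, h⟩
      · exact hlt h (hmono _ _ _ _ (hnot i j hij W₃ W₄ (Or.inl ⟨hstd i, hstd j, Or.inl h⟩)))
      · refine hlt h ?_
        rw [← hmono _ _ _ _ (hnot i j hij W₃ W₄ (Or.inr ⟨hstd j, hstd i, Or.inl h⟩)),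
          Multiset.pair_comm]
    refine ⟨?_, ?_, hsa, ?_⟩
    · intro V hV
      obtain ⟨i, -, rfl⟩ := Multiset.mem_map.1 hV
      exact (rep i).2
    · intro V hV
      obtain ⟨i, -, rfl⟩ := Multiset.mem_map.1 hV
      exact hstd i
    · intro V W hVW
      have hst := hsa V W hVW
      obtain ⟨i, j, rfl, rfl, hij⟩ := hpair V W hVW
      obtain ⟨W₃, W₄, h⟩ := exists_isTypeTwo (rep i) (rep j)
      obtain ⟨hsum, hprec⟩ := h.add_eq_and_precedes
      -- The vanishing sorting binomial says that `i`, `j` are the variables of the sorted pair;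
      -- `W₃` and `W₄` are standard as factors of a standard product, so they are the words of `i`
      -- and `j` up to order.
      have he := hmono _ _ _ _ (hnot i j hij W₃ W₄ (Or.inl ⟨hstd i, hstd j, Or.inr h⟩))
      have := congrArg (Multiset.map rep) he
      rw [← hsum] at hst
      simp only [Multiset.insert_eq_cons, Multiset.map_cons, Multiset.map_singleton,
        hrepx W₃ (hst.mono (Multiset.le_add_right _ _)),
        hrepx W₄ (hst.mono (Multiset.le_add_left _ _))] at this
      rw [← Multiset.insert_eq_cons, ← Multiset.insert_eq_cons] at this
      rcases multiset_pair_eq this with ⟨h1, h2⟩ | ⟨h1, h2⟩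
      · rw [h1, h2]
        exact Or.inl hprec
      · rw [h1, h2]
        exact Or.inr hprec
  have hwords : ∀ d, Finsupp.linearCombination ℕ a d = ((words d).sum.map b).sum := by
    intro d
    rw [linearCombination_eq_sum]
    simp only [words]
    induction Finsupp.toMultiset d using Multiset.induction_on with
    | empty => simp
    | cons i s ih =>
      simp only [Multiset.map_cons, Multiset.sum_cons, Multiset.map_add, Multiset.sum_add, ih]
      rw [← hax, hxrep]
  have hwinj : Function.Injective words := by
    intro d e h
    apply Finsupp.orderIsoMultiset.injective
    rw [Finsupp.coe_orderIsoMultiset]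
    refine Multiset.map_injective (f := fun i => (rep i : Multiset (Fin 6))) ?_ h
    exact hrepinj
  refine ⟨weightLex wt, ⟨?_, ?_⟩, hdeg⟩
  · refine isGroebnerBasis_of_binomials _ a _ ?_ ?_ ?_
    · refine (Set.finite_range fun W : Sym (Fin 6) n × Sym (Fin 6) n × Sym (Fin 6) n ×
        Sym (Fin 6) n => (X (x W.1) * X (x W.2.1) - X (x W.2.2.1) * X (x W.2.2.2) :
          MvPolynomial ι K)).subset ?_
      rintro g ⟨-, W₁, W₂, W₃, W₄, -, rfl⟩
      exact ⟨(W₁, W₂, W₃, W₄), rfl⟩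
    · rintro g ⟨hg, W₁, W₂, W₃, W₄, h, rfl⟩
      refine ⟨_, _, by rw [X_mul_X_eq, X_mul_X_eq], hord _ _ _ _ h hg, ?_⟩
      simpa using himage _ _ _ _ h
    · intro d e hd he hde
      rw [hwords, hwords, hb] at hde
      exact hwinj ((hred d hd).eq_of_sum_eq (by omega) (hred e he)
        (hde.eq_of_standard ((hred d hd).standard_sum hn) ((hred e he).standard_sum hn)))
  · refine ⟨(weightLex wt).degree '' labelledBinomials K x, ?_, ?_⟩
    · rintro _ ⟨g, ⟨hg, W₁, W₂, W₃, W₄, h, rfl⟩, rfl⟩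
      rw [hdeg _ _ _ _ h hg]
      simp [Finsupp.degree_single]
    · rw [initialIdeal, Set.image_image]
      congr 2
      ext g
      simp only [Set.mem_ofPred_eq, and_iff_left_iff_imp]
      exact fun h => h.1

end Groebner

/-! ### Lattice points of dilated Birkhoff polytopes -/

theorem birkhoffMonomial_apply (k : Fin 6) (i j : Fin 3) :
    birkhoffMonomial k (i, j) =
      if (![![0, 1, 2], ![1, 2, 0], ![2, 0, 1], ![0, 2, 1], ![1, 0, 2], ![2, 1, 0]] :
        Fin 6 → Fin 3 → Fin 3) k i = j then 1 else 0 := by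
  unfold birkhoffMonomial
  generalize (![![0, 1, 2], ![1, 2, 0], ![2, 0, 1], ![0, 2, 1], ![1, 0, 2], ![2, 1, 0]] :
        Fin 6 → Fin 3 → Fin 3) = P
  rw [Finsupp.finsetSum_apply, Finset.sum_eq_single i]
  · simp [Finsupp.single_apply]
  · intro l _ hl
    rw [Finsupp.single_apply, if_neg]
    simp [hl]
  · simp

theorem sum_map_birkhoffMonomial_apply (U : Multiset (Fin 6)) (p : Fin 3 × Fin 3) :
    (U.map birkhoffMonomial).sum p = ∑ k, U.count k * birkhoffMonomial k p := by
  induction U using Multiset.induction_on with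
  | empty => simp
  | cons j U ih =>
    simp only [Multiset.map_cons, Multiset.sum_cons, Finsupp.add_apply, ih, Multiset.count_cons,
      add_mul, Finset.sum_add_distrib, ite_mul, one_mul, zero_mul]
    simp [add_comm]

theorem sum_map_birkhoffMonomial_eq_iff (U : Multiset (Fin 6)) (a : Fin 3 × Fin 3 →₀ ℕ) :
    (U.map birkhoffMonomial).sum = a ↔
      U.count 0 + U.count 3 = a (0, 0) ∧ U.count 1 + U.count 4 = a (0, 1) ∧
      U.count 2 + U.count 5 = a (0, 2) ∧ U.count 2 + U.count 4 = a (1, 0) ∧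
      U.count 0 + U.count 5 = a (1, 1) ∧ U.count 1 + U.count 3 = a (1, 2) ∧
      U.count 1 + U.count 5 = a (2, 0) ∧ U.count 2 + U.count 3 = a (2, 1) ∧
      U.count 0 + U.count 4 = a (2, 2) := by
  rw [Finsupp.ext_iff, Prod.forall]
  simp [Fin.forall_fin_succ, sum_map_birkhoffMonomial_apply, Fin.sum_univ_six,
    birkhoffMonomial_apply, and_assoc]

theorem sum_map_birkhoffMonomial_eq_iff_cong (U V : Multiset (Fin 6)) :
    (U.map birkhoffMonomial).sum = (V.map birkhoffMonomial).sum ↔ Cong U V := by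
  obtain ⟨h1, h2, h3, h4, h5, h6, h7, h8, h9⟩ :=
    (sum_map_birkhoffMonomial_eq_iff V _).1 rfl
  rw [sum_map_birkhoffMonomial_eq_iff, ← h1, ← h2, ← h3, ← h4, ← h5, ← h6, ← h7, ← h8, ← h9]
  unfold Cong
  omega

theorem mem_latticeConfiguration_smul_iff {m : ℕ} (hm : 0 < m) (a : Fin 3 × Fin 3 →₀ ℕ) :
    a ∈ latticeConfiguration ((m : ℝ) • birkhoffPolytope) ↔
      (∀ k, ∑ i, a (i, k) = m) ∧ ∀ l, ∑ j, a (l, j) = m := by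
  have hm' : (m : ℝ) ≠ 0 := by positivity
  change _ ∈ (m : ℝ) • birkhoffPolytope ↔ _
  rw [Set.mem_smul_set_iff_inv_smul_mem₀ hm']
  simp only [birkhoffPolytope, transportationPolytope, Set.mem_ofPred_eq, Matrix.smul_apply,
    Matrix.of_apply, smul_eq_mul, ← Finset.mul_sum, Nat.cast_one, inv_mul_eq_one₀ hm']
  rw [and_iff_right (fun i j => by positivity)]
  simp only [← Nat.cast_sum, Nat.cast_inj, eq_comm (a := m)]

theorem mem_latticeConfiguration_smul_iff_exists {m : ℕ} (hm : 0 < m) (a : Fin 3 × Fin 3 →₀ ℕ) :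
    a ∈ latticeConfiguration ((m : ℝ) • birkhoffPolytope) ↔
      ∃ U : Multiset (Fin 6), U.card = m ∧ (U.map birkhoffMonomial).sum = a := by
  rw [mem_latticeConfiguration_smul_iff hm]
  simp only [sum_map_birkhoffMonomial_eq_iff, card_eq_sum_counts, Fin.forall_fin_succ,
    Fin.sum_univ_three]
  simp only [Fin.succ_zero_eq_one, Fin.succ_one_eq_two, IsEmpty.forall_iff, and_true]
  constructor
  · rintro ⟨⟨hc0, hc1, hc2⟩, hr0, hr1, hr2⟩
    -- Word 0 is the identity matrix, taken as often as the diagonal permits. The diagonal entries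
    -- then force the multiplicities of 3, 4, 5, and the rest of the first row those of 1 and 2.
    obtain ⟨t, ht⟩ : ∃ t, t = min (a (0, 0)) (min (a (1, 1)) (a (2, 2))) := ⟨_, rfl⟩
    refine ⟨Multiset.replicate t 0 + Multiset.replicate (a (0, 1) + t - a (2, 2)) 1 +
      Multiset.replicate (a (0, 2) + t - a (1, 1)) 2 + Multiset.replicate (a (0, 0) - t) 3 +
      Multiset.replicate (a (2, 2) - t) 4 + Multiset.replicate (a (1, 1) - t) 5, ?_⟩
    simp only [Multiset.count_add, Multiset.count_replicate, Fin.reduceEq, if_true, if_false]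
    omega
  · rintro ⟨U, hU, h⟩
    omega

theorem birkhoffMonomial_injective : Function.Injective birkhoffMonomial := by
  intro j k h
  have hc : Cong {j} {k} := by
    rw [← sum_map_birkhoffMonomial_eq_iff_cong]
    simpa using h
  have hs : ∀ l : Fin 6, Standard {l} := by
    intro l
    simp only [Standard, Multiset.mem_singleton]
    omega
  exact Multiset.singleton_inj.1 (hc.eq_of_standard (hs j) (hs k))

theorem range_birkhoffMonomial :
    Set.range birkhoffMonomial = latticeConfiguration birkhoffPolytope := by
  ext a
  have := mem_latticeConfiguration_smul_iff_exists one_pos a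
  rw [Nat.cast_one, one_smul] at this
  rw [this]
  constructor
  · rintro ⟨k, rfl⟩
    exact ⟨{k}, by simp, by simp⟩
  · rintro ⟨U, hU, rfl⟩
    obtain ⟨k, rfl⟩ := Multiset.card_eq_one.1 hU
    exact ⟨k, by simp⟩

theorem isConfiguration_range_birkhoffMonomial :
    IsConfiguration (Set.range birkhoffMonomial) := by
  -- The entries of a permutation matrix of size 3 sum to 3.
  refine ⟨Set.finite_range _, fun _ => 1 / 3, ?_⟩
  rintro _ ⟨k, rfl⟩
  have hk := (mem_latticeConfiguration_smul_iff one_pos (birkhoffMonomial k)).1 (by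
    rw [Nat.cast_one, one_smul, ← range_birkhoffMonomial]
    exact ⟨k, rfl⟩)
  rw [Finsupp.sum_fintype _ _ (by simp), ← Finset.mul_sum, ← Nat.cast_sum,
    Fintype.sum_prod_type, Finset.sum_congr rfl fun l _ => hk.2 l]
  simp

/-! ### The toric ideal of a configuration of six monomials -/

section Ideal

variable {K : Type*} [Field K] {τ : Type*}

theorem cubicBinomial_eq :
    (X 0 * X 1 * X 2 - X 3 * X 4 * X 5 : MvPolynomial (Fin 6) K) =
      monomial (Multiset.toFinsupp {0, 1, 2}) 1 - monomial (Multiset.toFinsupp {3, 4, 5}) 1 := by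
  simp [X, monomial_mul, Multiset.insert_eq_cons, ← Multiset.singleton_add, add_assoc]

theorem linearCombination_toFinsupp (b : Fin 6 → τ →₀ ℕ) (U : Multiset (Fin 6)) :
    Finsupp.linearCombination ℕ b (Multiset.toFinsupp U) = (U.map b).sum := by
  rw [linearCombination_eq_sum, Multiset.toFinsupp_toMultiset]

theorem cubicBinomial_mem_iff (b : Fin 6 → τ →₀ ℕ) :
    (X 0 * X 1 * X 2 - X 3 * X 4 * X 5 : MvPolynomial (Fin 6) K) ∈ toricIdealOfFamily K b ↔
      b 0 + b 1 + b 2 = b 3 + b 4 + b 5 := by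
  rw [cubicBinomial_eq, monomial_sub_mem_toricIdealOfFamily_iff, linearCombination_toFinsupp,
    linearCombination_toFinsupp]
  simp [Multiset.insert_eq_cons, add_assoc]

/-- Congruent words give congruent monomials modulo the cubic binomial. -/
theorem monomial_sub_mem_of_cong {U V : Multiset (Fin 6)} (h : Cong U V) :
    monomial (Multiset.toFinsupp U) (1 : K) - monomial (Multiset.toFinsupp V) 1 ∈
      Ideal.span {(X 0 * X 1 * X 2 - X 3 * X 4 * X 5 : MvPolynomial (Fin 6) K)} := by
  set J := Ideal.span {(X 0 * X 1 * X 2 - X 3 * X 4 * X 5 : MvPolynomial (Fin 6) K)} with hJ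
  -- In the quotient by the cubic the classes of the variables satisfy the defining relation, so
  -- `Cong.sum_eq` applies to its multiplicative monoid.
  let b : Fin 6 → Additive (MvPolynomial (Fin 6) K ⧸ J) := fun j =>
    Additive.ofMul (Ideal.Quotient.mk J (X j))
  have hb : b 0 + b 1 + b 2 = b 3 + b 4 + b 5 := by
    simp only [b, ← ofMul_mul, ← map_mul]
    exact congrArg Additive.ofMul (Ideal.Quotient.eq.2 (Ideal.subset_span rfl))
  have hprod : ∀ U : Multiset (Fin 6), Additive.ofMul (Ideal.Quotient.mk J
      (monomial (Multiset.toFinsupp U) 1)) = (U.map b).sum := by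
    intro U
    induction U using Multiset.induction_on with
    | empty => simp
    | cons j U ih =>
      rw [Multiset.map_cons, Multiset.sum_cons, ← ih, ← Multiset.singleton_add, map_add,
        Multiset.toFinsupp_singleton, ← one_mul (1 : K), ← monomial_mul, map_mul, one_mul]
      rfl
  rw [← Ideal.Quotient.eq]
  exact Additive.ofMul.injective (by rw [hprod, hprod, h.sum_eq hb])

theorem toricIdealOfFamily_birkhoffMonomial :
    toricIdealOfFamily K birkhoffMonomial =
      Ideal.span {(X 0 * X 1 * X 2 - X 3 * X 4 * X 5 : MvPolynomial (Fin 6) K)} := by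
  have hrel : birkhoffMonomial 0 + birkhoffMonomial 1 + birkhoffMonomial 2 =
      birkhoffMonomial 3 + birkhoffMonomial 4 + birkhoffMonomial 5 := by
    have := (sum_map_birkhoffMonomial_eq_iff_cong {0, 1, 2} {3, 4, 5}).2 (cong_insert 0)
    simpa [Multiset.insert_eq_cons, add_assoc] using this
  refine le_antisymm (toricIdealOfFamily_le _ _ fun d e h => ?_) ?_
  · rw [linearCombination_eq_sum, linearCombination_eq_sum,
      sum_map_birkhoffMonomial_eq_iff_cong] at h
    simpa using monomial_sub_mem_of_cong (K := K) h
  · rw [Ideal.span_singleton_le_iff_mem, cubicBinomial_mem_iff]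
    exact hrel

/-- Equality of images depends only on the toric ideal, so it can be tested on the Birkhoff
monomials, whose toric ideal is the same and where it is explicit linear arithmetic. -/
theorem sum_map_eq_iff_cong {b : Fin 6 → τ →₀ ℕ}
    (hI : toricIdealOfFamily K b =
      Ideal.span {(X 0 * X 1 * X 2 - X 3 * X 4 * X 5 : MvPolynomial (Fin 6) K)})
    (U V : Multiset (Fin 6)) : (U.map b).sum = (V.map b).sum ↔ Cong U V := by
  constructor
  · intro h
    rw [← linearCombination_toFinsupp, ← linearCombination_toFinsupp,
      ← monomial_sub_mem_toricIdealOfFamily_iff (K := K), hI,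
      ← toricIdealOfFamily_birkhoffMonomial, monomial_sub_mem_toricIdealOfFamily_iff,
      linearCombination_toFinsupp, linearCombination_toFinsupp,
      sum_map_birkhoffMonomial_eq_iff_cong] at h
    exact h
  · intro h
    refine h.sum_eq ?_
    rw [← cubicBinomial_mem_iff (K := K), hI]
    exact Ideal.subset_span rfl

end Ideal

/-! ### Words and the elements of the nested configuration -/

theorem wordIndex_surjective {σ : Type*} (b : Fin 6 → σ →₀ ℕ) (n : ℕ) :
    Function.Surjective (wordIndex b : Sym (Fin 6) n → powerNested n (Set.range b)) := by
  rintro ⟨M, s, hs, hsB, rfl⟩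
  have hlift : ∃ U : Multiset (Fin 6),
      s = U.map fun j => (⟨0, b j⟩ : Σ _ : Fin 1, σ →₀ ℕ) := by
    clear hs
    induction s using Multiset.induction_on with
    | empty => exact ⟨0, rfl⟩
    | cons p s ih =>
      obtain ⟨U, rfl⟩ := ih fun q hq => hsB q (Multiset.mem_cons_of_mem hq)
      obtain ⟨j, hj⟩ := hsB p (Multiset.mem_cons_self _ _)
      obtain ⟨i, m⟩ := p
      obtain rfl : i = 0 := Subsingleton.elim _ _
      refine ⟨j ::ₘ U, ?_⟩
      rw [Multiset.map_cons]
      congr 2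
      exact hj.symm
  obtain ⟨U, rfl⟩ := hlift
  have hU : U.card = n := by
    have := congrArg (fun f : Fin 1 →₀ ℕ => f 0) (Set.mem_singleton_iff.1 hs)
    simpa [Multiset.map_map] using this
  refine ⟨⟨U, hU⟩, Subtype.ext ?_⟩
  simp only [wordIndex, Multiset.map_map]
  rfl

theorem sum_map_embedMonomial {σ : Type*} (b : Fin 6 → σ →₀ ℕ) (U : Multiset (Fin 6)) :
    (U.map fun j => embedMonomial (ι := Fin 1) (σ := fun _ => σ) 0 (b j)).sum =
      embedMonomial (ι := Fin 1) (σ := fun _ => σ) 0 (U.map b).sum := by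
  have := map_multiset_sum (Finsupp.embDomain.addMonoidHom
    (Function.Embedding.sigmaMk (β := fun _ : Fin 1 => σ) 0) : (σ →₀ ℕ) →+ _) (U.map b)
  rw [Multiset.map_map] at this
  exact this.symm

end NestedToric

/-! ### Application to nested configurations and to dilated Birkhoff polytopes -/

theorem mainTheorem7 (K : Type*) [Field K] :
    (∀ (σ : Type) [Finite σ] (b : Fin 6 → σ →₀ ℕ), Function.Injective b →
      NestedToric.IsConfiguration (Set.range b) →
      NestedToric.toricIdealOfFamily K b =
        Ideal.span {(X 0 * X 1 * X 2 - X 3 * X 4 * X 5 : MvPolynomial (Fin 6) K)} →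
      ∀ n : ℕ, 1 < n →
        ∃ ord : MonomialOrder.{0, 0} (NestedToric.powerNested n (Set.range b)),
          NestedToric.IsQuadraticGroebnerBasis ord
            (NestedToric.toricIdeal K (NestedToric.powerNested n (Set.range b)))
            (NestedToric.quadraticBinomials K b n) ∧
          ∀ W₁ W₂ W₃ W₄ : Sym (Fin 6) n, NestedToric.IsAdmissible W₁ W₂ W₃ W₄ →
            NestedToric.wordBinomial K b W₁ W₂ W₃ W₄ ≠ 0 →
            ord.degree (NestedToric.wordBinomial K b W₁ W₂ W₃ W₄) =
              Finsupp.single (NestedToric.wordIndex b W₁) 1 +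
                Finsupp.single (NestedToric.wordIndex b W₂) 1) ∧
    (Function.Injective NestedToric.birkhoffMonomial ∧
      Set.range NestedToric.birkhoffMonomial =
        NestedToric.latticeConfiguration NestedToric.birkhoffPolytope ∧
      NestedToric.IsConfiguration (Set.range NestedToric.birkhoffMonomial) ∧
      NestedToric.toricIdealOfFamily K NestedToric.birkhoffMonomial =
        Ideal.span {(X 0 * X 1 * X 2 - X 3 * X 4 * X 5 : MvPolynomial (Fin 6) K)}) ∧
    (∀ m : ℕ, 1 < m →
      ∃ (ord : MonomialOrder.{0, 0}
          (NestedToric.latticeConfiguration ((m : ℝ) • NestedToric.birkhoffPolytope)))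
        (G : Set (MvPolynomial
          (NestedToric.latticeConfiguration ((m : ℝ) • NestedToric.birkhoffPolytope)) K)),
        NestedToric.IsQuadraticGroebnerBasis ord
          (NestedToric.toricIdeal K
            (NestedToric.latticeConfiguration ((m : ℝ) • NestedToric.birkhoffPolytope))) G) := by
  open NestedToric in
  refine ⟨?_, ⟨birkhoffMonomial_injective, range_birkhoffMonomial,
    isConfiguration_range_birkhoffMonomial, toricIdealOfFamily_birkhoffMonomial⟩, ?_⟩
  · intro σ _ b _ _ hI n hn
    have := Finite.of_surjective _ (wordIndex_surjective b n)
    refine exists_quadraticGroebnerBasis hn _ Subtype.val_injective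
      (fun j => embedMonomial (ι := Fin 1) (σ := fun _ => σ) 0 (b j)) (wordIndex b)
      (wordIndex_surjective b n) (fun W => rfl) fun U V => ?_
    rw [sum_map_embedMonomial, sum_map_embedMonomial, ← sum_map_eq_iff_cong hI]
    exact (Finsupp.embDomain_injective _).eq_iff
  · intro m hm
    have hmem := fun a => mem_latticeConfiguration_smul_iff_exists (zero_lt_one.trans hm) a
    -- Words label the lattice points directly; surjectivity is the decomposition into `m`
    -- permutation matrices.
    let x : Sym (Fin 6) m → latticeConfiguration ((m : ℝ) • birkhoffPolytope) := fun W =>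
      ⟨((W : Multiset (Fin 6)).map birkhoffMonomial).sum, (hmem _).2 ⟨W, W.2, rfl⟩⟩
    have hx : Function.Surjective x := by
      rintro ⟨a, ha⟩
      obtain ⟨U, hU, rfl⟩ := (hmem a).1 ha
      exact ⟨⟨U, hU⟩, rfl⟩
    have := Finite.of_surjective x hx
    obtain ⟨ord, h, -⟩ := exists_quadraticGroebnerBasis (K := K) hm _ Subtype.val_injective
      birkhoffMonomial x hx (fun W => rfl) sum_map_birkhoffMonomial_eq_iff_cong
    exact ⟨ord, _, h⟩
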